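/- **Setting.** Let $Z,A,M,Y$ be random variables with arbitrary state spaces and a joint density $p=p(Z,A,M,Y)$ with respect to a product of $\sigma$-finite measures, $p>0$ almost everywhere (sums below stand for integrals, and equalities hold almost everywhere). An ADMG has directed edges ($\to$, without directed cycles) and bidirected edges ($\leftrightarrow$); in a CADMG some vertices are fixed and have no incoming arrowheads. For an ADMG $\mathcal G$ on $V$ and $S\subseteq V$ let $\mathcal G(V\setminus S,S)$ be the CADMG obtained by deleting all arrowheads into $S$. Districts are the bidirected-connected components of the random vertices. A random vertex $v$ is fixable if no other random vertex is reached from $v$ both by a directed and by a bidirected path; fixing $v$ deletes the arrowheads into $v$ and divides the kernel $q(R\mid W)$ by $q(v\mid \mathrm{mb}(v),W)$, where the Markov blanket $\mathrm{mb}(v)$ consists of the district of $v$ and its parents, without $v$. A set $D$ is intrinsic in $\mathcal G$ if $V\setminus D$ can be fixed successively, leaving the single district $D$. The density $p$ nested Markov factorizes with respect to $\mathcal G$ if there are kernels $q_D(D\mid \mathrm{pa}_{\mathcal G}(D))$, one for each intrinsic $D$, such that for every valid fixing sequence the resulting kernel is the product of the $q_D$ over the districts $D$ of the resulting CADMG.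 The post-intervention distribution $p(V\setminus S\mid \mathrm{do}(S))$ is identified in $\mathcal G$ if every district of $\mathcal G(V\setminus S,S)$ is intrinsic in $\mathcal G$. **Assumptions.** Let $p$ nested Markov factorize with respect to an ADMG $\mathcal G$ on $\{Z,A,M,Y\}$ such that: - (A1) $M$ is a mediator between $A$ and $Y$, i.e. it lies on a directed path from $A$ to $Y$ in $\mathcal G$. - (A2) $Z$ is not a descendant of $A$ in $\mathcal G$, and $Z\not\perp A$ and $Z\not\perp Y\mid A,M$ in $p$. - (A3) (Verma faithfulness) Every ordinary conditional independence between two variables in $p$ implies the corresponding m-separation in $\mathcal G$. Moreover, let $a,b$ be two variables that are not independent in $p$ given any set of the other variables, let $S$ and $C$ be disjoint sets of variables not containing $a,b$, and let $\prec$ be a topological order of $\mathcal G$; if $a\perp b\mid C$ in the g-formula kernel $p(V)/\prod_{s\in S}p(s\mid\{u: u\prec s\})$, with the variables in $S$ fixed, then $p(V\setminus S\mid\mathrm{do}(S))$ is identified in $\mathcal G$, and $a$ and $b$ are m-separated given $C$ (and the fixed $S$) in $\mathcal G(V\setminus S,S)$. **Pattern.** Let $\mathcal P$ be the set of ADMGs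 on $\{Z,A,M,Y\}$ that contain $A\to M$, $M\to Y$, $A\leftrightarrow Y$, have no other edges except possibly $Z\to A$, $Z\leftrightarrow A$, $Z\to M$, $Z\leftrightarrow M$, contain at least one of $Z\to A$ and $Z\leftrightarrow A$, and have no bidirected path from $A$ to $M$. **Theorem.** 1. If (A1)–(A3) hold and $Z\perp Y$ in $p(Z,A,M,Y)/p(M\mid A,Z)$ (a kernel for $Z,A,Y$ with $M$ fixed), then $p$ nested Markov factorizes with respect to an ADMG, namely $\mathcal G$, in which $A$ has no bidirected path to any of its children. In particular, (F1) $A\to Y$ is absent from $\mathcal G$, (F2) $A\leftrightarrow M$ and $M\leftrightarrow Y$ are absent from $\mathcal G$, and $\mathcal G\in\mathcal P$. 2. $\mathcal P$ is exactly the set of admissible ADMGs on $\{Z,A,M,Y\}$, i.e. those in which $M$ lies on a directed path from $A$ to $Y$, $Z$ is not a descendant of $A$, $Z$ is m-connected to $A$ given $\emptyset$ and to $Y$ given $\{A,M\}$, $p(Z,A,Y\mid\mathrm{do}(M))$ is identified, and $Z$ and $Y$ are m-separated in the CADMG in which $M$ is fixed. Moreover, for every $\mathcal H\in\mathcal P$,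 every almost everywhere positive density that nested Markov factorizes with respect to $\mathcal H$ satisfies $Z\perp Y$ in $p(Z,A,M,Y)/p(M\mid A,Z)$. -/

import Mathlib

open MeasureTheory
open scoped ENNReal

/-! ### Conditional acyclic directed mixed graphs -/

/-- A conditional ADMG on the vertex type `V`: the vertices in `rand` are random, the others are
fixed. `dir u v` is the edge `u → v`, `bi u v` is the edge `u ↔ v`. No arrowhead points at a fixed
vertex. -/
structure CADMG (V : Type*) where
  rand : Finset V
  dir : V → V → Prop
  bi : V → V → Prop
  bi_symm : ∀ u v, bi u v → bi v u
  bi_irrefl : ∀ v, ¬ bi v v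
  acyclic : ∀ v, ¬ Relation.TransGen dir v v
  dir_rand : ∀ u v, dir u v → v ∈ rand
  bi_rand : ∀ u v, bi u v → u ∈ rand

/-- The kinds of edges met when a path is traversed: `→`, `←`, `↔`. -/
inductive EdgeKind where
  | fwd
  | bwd
  | bidir

/-- The edge has an arrowhead at the vertex where its traversal ends. -/
def EdgeKind.headAtEnd : EdgeKind → Prop
  | .fwd => True
  | .bwd => False
  | .bidir => True

/-- The edge has an arrowhead at the vertex where its traversal starts. -/
def EdgeKind.headAtStart : EdgeKind → Prop
  | .fwd => False
  | .bwd => True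
  | .bidir => True

namespace CADMG

variable {V : Type*}

/-- `G` has the edge from `u` to `v` of the given kind. -/
def HasEdge (G : CADMG V) (u : V) : EdgeKind → V → Prop
  | .fwd, v => G.dir u v
  | .bwd, v => G.dir v u
  | .bidir, v => G.bi u v

/-- The walk that starts at a vertex and follows the listed edges is open given `C`: every inner
collider is an ancestor of a vertex of `C` (or in `C`), every inner non-collider is outside `C`. -/
def OpenWalk (G : CADMG V) (C : Finset V) : V → List (EdgeKind × V) → Prop
  | _, [] => True
  | x, [(k, y)] => G.HasEdge x k y
  | x, (k₁, v) :: (k₂, w) :: l =>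
      G.HasEdge x k₁ v ∧
      ((k₁.headAtEnd ∧ k₂.headAtStart) → ∃ c ∈ C, Relation.ReflTransGen G.dir v c) ∧
      (¬ (k₁.headAtEnd ∧ k₂.headAtStart) → v ∉ C) ∧
      OpenWalk G C v ((k₂, w) :: l)

/-- m-separation of two vertices given `C`: no path (without repeated vertices) between them is
open given `C`. -/
def MSep (G : CADMG V) (x y : V) (C : Finset V) : Prop :=
  ¬ ∃ l : List (EdgeKind × V),
      l.map Prod.snd ≠ [] ∧ (l.map Prod.snd).getLast? = some y ∧
      (x :: l.map Prod.snd).Nodup ∧ G.OpenWalk C x l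

/-- A random vertex is fixable if no other random vertex is reached from it both by a directed path
and by a bidirected path. -/
def Fixable (G : CADMG V) (v : V) : Prop :=
  v ∈ G.rand ∧ ∀ u ∈ G.rand, u ≠ v →
    ¬ (Relation.TransGen G.dir v u ∧ Relation.TransGen G.bi v u)

variable [DecidableEq V]

/-- The CADMG in which the vertices of `S` are fixed: all arrowheads into `S` are removed. -/
def fixSet (G : CADMG V) (S : Finset V) : CADMG V where
  rand := G.rand \ S
  dir u v := G.dir u v ∧ v ∉ S
  bi u v := G.bi u v ∧ u ∉ S ∧ v ∉ S
  bi_symm u v h := ⟨G.bi_symm u v h.1, h.2.2, h.2.1⟩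
  bi_irrefl v h := G.bi_irrefl v h.1
  acyclic v h := G.acyclic v (Relation.TransGen.mono (fun _ _ h => h.1) _ _ h)
  dir_rand u v h := Finset.mem_sdiff.2 ⟨G.dir_rand u v h.1, h.2⟩
  bi_rand u v h := Finset.mem_sdiff.2 ⟨G.bi_rand u v h.1, h.2.1⟩

/-- The list is a valid fixing sequence. -/
def ValidFixing : CADMG V → List V → Prop
  | _, [] => True
  | G, v :: l => G.Fixable v ∧ ValidFixing (G.fixSet {v}) l

/-- Fixing the vertices of a list, one after the other. -/
def fixSeq : CADMG V → List V → CADMG V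
  | G, [] => G
  | G, v :: l => fixSeq (G.fixSet {v}) l

variable [Fintype V]

/-- An ADMG is a CADMG without fixed vertices. -/
def IsADMG (G : CADMG V) : Prop := G.rand = Finset.univ

open Classical in
/-- The district of a vertex: the random vertices that are joined to it by a bidirected path. -/
noncomputable def district (G : CADMG V) (v : V) : Finset V :=
  G.rand.filter fun u => Relation.ReflTransGen G.bi v u

/-- The set of districts. -/
noncomputable def districts (G : CADMG V) : Finset (Finset V) :=
  G.rand.image G.district

open Classical in
/-- The parents of the vertices of a set. -/
noncomputable def parents (G : CADMG V) (D : Finset V) : Finset V :=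
  Finset.univ.filter fun u => ∃ v ∈ D, G.dir u v

/-- The Markov blanket: the district and the parents of the district, without the vertex itself. -/
noncomputable def mb (G : CADMG V) (v : V) : Finset V :=
  (G.district v ∪ G.parents (G.district v)).erase v

/-- `D` is intrinsic in the ADMG `G`: its complement can be fixed, and fixing it leaves the single
district `D`. -/
def Intrinsic (G : CADMG V) (D : Finset V) : Prop :=
  ∃ l : List V, G.ValidFixing l ∧ l.toFinset = Finset.univ \ D ∧
    (G.fixSeq l).districts = {D}

/-- The post-intervention distribution `p(V \ S | do(S))` is identified in the ADMG `G`: every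
district of the CADMG in which `S` is fixed is intrinsic in `G`. -/
def Identified (G : CADMG V) (S : Finset V) : Prop :=
  ∀ D ∈ (G.fixSet S).districts, G.Intrinsic D

/-- The order of the vertices given by the injective ranking `r` is a topological order of `G`. -/
def IsTopological (G : CADMG V) (r : V → ℕ) : Prop :=
  Function.Injective r ∧ ∀ u v, G.dir u v → r u < r v

end CADMG

/-! ### Kernels and the nested Markov factorization

All densities and kernels are functions on the full product of the state spaces, with respect to a
product of σ-finite reference measures; `∫⋯∫⁻_T` integrates out the coordinates in `T` (a sum over
them if the reference measures are counting measures). -/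

section Kernels

variable {V : Type*} [Fintype V] [DecidableEq V] {X : V → Type*} [∀ v, MeasurableSpace (X v)]
  (μ : ∀ v, Measure (X v))

/-- A joint probability density that is positive almost everywhere. -/
structure IsPosDensity (p : (∀ v, X v) → ℝ≥0∞) : Prop where
  measurable : Measurable p
  lintegral_eq_one : ∫⁻ x, p x ∂(Measure.pi μ) = 1
  pos : ∀ᵐ x ∂(Measure.pi μ), 0 < p x

/-- The margin `q(T | W)` of a kernel `q(R | W)` with random variables `R`. -/
noncomputable def kernelMargin (R : Finset V) (q : (∀ v, X v) → ℝ≥0∞) (T : Finset V) :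
    (∀ v, X v) → ℝ≥0∞ :=
  lmarginal μ (R \ T) q

/-- The conditional kernel `q(v | C, W)` of a kernel `q(R | W)` with random variables `R`. -/
noncomputable def kernelCond (R : Finset V) (q : (∀ v, X v) → ℝ≥0∞) (v : V) (C : Finset V) :
    (∀ v, X v) → ℝ≥0∞ :=
  fun x => kernelMargin μ R q (insert v C) x / kernelMargin μ R q C x

/-- Independence of the random variables `a` and `b` given `C` in a kernel `q(R | W)`:
`q(a, b, C | W) q(C | W) = q(a, C | W) q(b, C | W)`. -/
def KernelIndep (R : Finset V) (q : (∀ v, X v) → ℝ≥0∞) (a b : V) (C : Finset V) : Prop :=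
  ∀ᵐ x ∂(Measure.pi μ),
    kernelMargin μ R q (insert a (insert b C)) x * kernelMargin μ R q C x =
      kernelMargin μ R q (insert a C) x * kernelMargin μ R q (insert b C) x

/-- Ordinary conditional independence of `a` and `b` given `C` under the density `p`. -/
def DensityIndep (p : (∀ v, X v) → ℝ≥0∞) (a b : V) (C : Finset V) : Prop :=
  KernelIndep μ Finset.univ p a b C

/-- The kernel obtained from `q` by fixing the vertices of a list in `G`, one after the other: to
fix `v`, divide by the conditional kernel of `v` given its Markov blanket and the fixed variables. -/
noncomputable def fixKernel : CADMG V → List V → ((∀ v, X v) → ℝ≥0∞) → ((∀ v, X v) → ℝ≥0∞)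
  | _, [], q => q
  | G, v :: l, q =>
      fixKernel (G.fixSet {v}) l fun x => q x / kernelCond μ G.rand q v (G.mb v) x

/-- `q` is a kernel `q(D | P)`: it depends on the variables in `D ∪ P` only and is a normalized
density over `D` for all values of the other variables. -/
structure IsKernel (D P : Finset V) (q : (∀ v, X v) → ℝ≥0∞) : Prop where
  measurable : Measurable q
  dependsOn : DependsOn q (↑(D ∪ P) : Set V)
  normalized : ∀ x, lmarginal μ D q x = 1

/-- The nested Markov factorization of the density `p` with respect to the ADMG `G`. -/
def NestedMarkov (p : (∀ v, X v) → ℝ≥0∞) (G : CADMG V) : Prop :=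
  ∃ q : Finset V → ((∀ v, X v) → ℝ≥0∞),
    (∀ D, G.Intrinsic D → IsKernel μ D (G.parents D) (q D)) ∧
    ∀ l : List V, G.ValidFixing l →
      fixKernel μ G l p =ᵐ[Measure.pi μ] fun x => ∏ D ∈ (G.fixSeq l).districts, q D x

/-- The g-formula for an intervention on `S`, with respect to the order of the variables given by
`r`: from the chain-rule factorization of `p` the factors of the variables in `S` are dropped. -/
noncomputable def gFormula (p : (∀ v, X v) → ℝ≥0∞) (r : V → ℕ) (S : Finset V) :
    (∀ v, X v) → ℝ≥0∞ :=
  fun x => p x /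
    ∏ s ∈ S, kernelCond μ Finset.univ p s (Finset.univ.filter fun u => r u < r s) x

/-- Verma faithfulness of `p` to `G`. Every ordinary independence is due to m-separation. If two
variables admit no ordinary independence, but are independent in a post-intervention distribution
obtained from `p` by the g-formula (along a topological order of `G`), then this post-intervention
distribution is identified in `G` and the independence is due to m-separation in its CADMG. The
fixed variables of a CADMG are held constant, so they belong to the conditioning set. -/
structure VermaFaithful (p : (∀ v, X v) → ℝ≥0∞) (G : CADMG V) : Prop where
  ordinary : ∀ (a b : V) (C : Finset V), a ≠ b → a ∉ C → b ∉ C →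
    DensityIndep μ p a b C → G.MSep a b C
  generalized : ∀ (r : V → ℕ) (S C : Finset V) (a b : V), G.IsTopological r → Disjoint S C →
    a ≠ b → a ∉ S ∪ C → b ∉ S ∪ C →
    (∀ C' : Finset V, a ∉ C' → b ∉ C' → ¬ DensityIndep μ p a b C') →
    KernelIndep μ (Finset.univ \ S) (gFormula μ p r S) a b C →
    G.Identified S ∧ (G.fixSet S).MSep a b (S ∪ C)

end Kernels

/-! ### Anchor, treatment, mediator and outcome -/

/-- The anchor, the treatment, the mediator and the outcome. -/
inductive Var where
  | Z
  | A
  | M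
  | Y
  deriving DecidableEq

instance : Fintype Var where
  elems := {Var.Z, Var.A, Var.M, Var.Y}
  complete v := by cases v <;> decide

namespace FrontDoor

open Var

/-- `M` is a mediator between `A` and `Y`: it lies on a directed path from `A` to `Y`. -/
def Mediates (G : CADMG Var) : Prop :=
  Relation.TransGen G.dir A M ∧ Relation.TransGen G.dir M Y

/-- `Z` is not a causal consequence of `A`. -/
def NotConsequence (G : CADMG Var) : Prop :=
  ¬ Relation.TransGen G.dir A Z

/-- `A` has no bidirected path to any of its children. -/
def NoBidirectedPathToChild (G : CADMG Var) : Prop :=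
  ∀ c, G.dir A c → ¬ Relation.TransGen G.bi A c

/-- The ADMGs of the pattern: the edges `A → M`, `M → Y`, `A ↔ Y` are present; the edges `Z → A`,
`Z ↔ A`, `Z → M`, `Z ↔ M` are optional; there are no other edges; one of `Z → A`, `Z ↔ A` is
present; and `A` has no bidirected path to `M`. -/
structure InPattern (G : CADMG Var) : Prop where
  isADMG : G.IsADMG
  dir_A_M : G.dir A M
  dir_M_Y : G.dir M Y
  bi_A_Y : G.bi A Y
  dir_only : ∀ u v, G.dir u v →
    (u = Z ∧ v = A) ∨ (u = Z ∧ v = M) ∨ (u = A ∧ v = M) ∨ (u = M ∧ v = Y)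
  bi_only : ∀ u v, G.bi u v →
    s(u, v) = s(Z, A) ∨ s(u, v) = s(Z, M) ∨ s(u, v) = s(A, Y)
  anchor : G.dir Z A ∨ G.bi Z A
  no_path : ¬ Relation.TransGen G.bi A M

/-- The ADMG `G` is admissible: `M` mediates between `A` and `Y`; `Z` is not a causal consequence of
`A`, and is m-connected to `A`, and to `Y` given `A` and `M`; `p(Z, A, Y | do(M))` is identified and
`Z`, `Y` are m-separated in its CADMG. -/
structure Admissible (G : CADMG Var) : Prop where
  isADMG : G.IsADMG
  mediates : Mediates G
  notConsequence : NotConsequence G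
  relevant_A : ¬ G.MSep Z A ∅
  relevant_Y : ¬ G.MSep Z Y {A, M}
  identified : G.Identified {M}
  mSep : (G.fixSet {M}).MSep Z Y {M}

variable {X : Var → Type*} [∀ v, MeasurableSpace (X v)] (μ : ∀ v, Measure (X v))

/-- The Verma constraint: `Z` and `Y` are independent in the kernel
`p(Z, A, M, Y) / p(M | A, Z)` with random variables `Z`, `A`, `Y`. -/
def VermaConstraint (p : (∀ v, X v) → ℝ≥0∞) : Prop :=
  KernelIndep μ {Z, A, Y} (fun x => p x / kernelCond μ Finset.univ p M {A, Z} x) Z Y ∅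

end FrontDoor

/-!
For distinct `a`, `b` such that `{a, b} ∪ C` is ancestral, margining out the other vertices amounts
to fixing them, the last ones first. No district of the resulting CADMG has both `a` and `b` among
its members and parents if `a` and `b` are m-separated, so its product of kernels splits: the
ordinary Markov property and, started from a kernel with `M` fixed, the Verma constraint are both
instances.

Conversely, identifiability of `do(M)` forbids a bidirected path from `M` to its child `Y`, and
m-separation of `Z` and `Y` once `M` is fixed forbids `A → Y` next to an anchor edge of `Z` and `A`.
The dependence of `Z` and `Y` given `{A, M}` can then only come from `A ↔ Y`, which extends the ban
on bidirected paths to those from `A` to `M`. Faithfulness supplies the two premises, since `Z` and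
`Y` cannot be separated by ordinary conditioning.
-/
section Marginals

variable {V : Type*} {X : V → Type*}

theorem dependsOn_finsetProd {ι : Type*} (s : Finset ι) {f : ι → (∀ v, X v) → ℝ≥0∞} {T : Set V}
    (hf : ∀ i ∈ s, DependsOn (f i) T) : DependsOn (fun x => ∏ i ∈ s, f i x) T :=
  fun _ _ hxy => Finset.prod_congr rfl fun i hi => hf i hi hxy

variable [DecidableEq V]

theorem apply_updateFinset_of_dependsOn_compl {S : Finset V} {f : (∀ v, X v) → ℝ≥0∞}
    (hf : DependsOn f (↑S : Set V)ᶜ) (x : ∀ v, X v) (y : ∀ v : S, X v) :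
    f (Function.updateFinset x S y) = f x :=
  hf fun _ hi => dif_neg (by simpa using hi)

variable [∀ v, MeasurableSpace (X v)] {μ : ∀ v, Measure (X v)} {S T : Finset V}
  {f g : (∀ v, X v) → ℝ≥0∞}

theorem dependsOn_lmarginal {T : Set V} (hf : DependsOn f T) (S : Finset V) :
    DependsOn (lmarginal μ S f) T := by
  refine fun x y hxy => lintegral_congr fun z => hf fun i hi => ?_
  simp only [Function.updateFinset, hxy i hi]

theorem dependsOn_lmarginal_compl (S : Finset V) (f : (∀ v, X v) → ℝ≥0∞) :
    DependsOn (lmarginal μ S f) (↑S : Set V)ᶜ := fun _ _ hxy =>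
  lmarginal_congr μ f fun i hi => hxy i (by simpa using hi)

theorem lmarginal_mul_of_dependsOn_compl (hg : DependsOn g (↑S : Set V)ᶜ) (hf : Measurable f) :
    lmarginal μ S (fun x => g x * f x) = fun x => g x * lmarginal μ S f x := by
  ext x
  simp only [lmarginal, apply_updateFinset_of_dependsOn_compl hg]
  exact lintegral_const_mul _ (hf.comp measurable_updateFinset)

variable [∀ v, SigmaFinite (μ v)]

theorem lmarginal_lmarginal_sdiff (hf : Measurable f) (hST : S ⊆ T) :
    lmarginal μ (T \ S) (lmarginal μ S f) = lmarginal μ T f := by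
  rw [← lmarginal_union μ f hf Finset.sdiff_disjoint, Finset.sdiff_union_of_subset hST]

variable [Fintype V] {P : (∀ v, X v) → Prop}

theorem measurePreserving_pi_of_prod (S : Finset V) :
    MeasurePreserving
      (fun z : (∀ v : {v // v ∉ S}, X v) × (∀ v : S, X v) => fun v =>
        if h : v ∈ S then z.2 ⟨v, h⟩ else z.1 ⟨v, h⟩)
      ((Measure.pi fun v : {v // v ∉ S} => μ v).prod (Measure.pi fun v : S => μ v))
      (Measure.pi μ) := by
  convert ((measurePreserving_piEquivPiSubtypeProd μ (· ∈ S)).symm _).comp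
    Measure.measurePreserving_swap
  rfl

theorem ae_ae_updateFinset (h : ∀ᵐ x ∂Measure.pi μ, P x) (S : Finset V) :
    ∀ᵐ x ∂Measure.pi μ, ∀ᵐ y ∂Measure.pi fun v : S => μ v, P (Function.updateFinset x S y) :=
  (Measure.quasiMeasurePreserving_snd.comp
    (measurePreserving_piEquivPiSubtypeProd μ (· ∈ S)).quasiMeasurePreserving).ae <|
    Measure.ae_ae_of_ae_prod <|
      (measurePreserving_pi_of_prod (μ := μ) S).quasiMeasurePreserving.ae h

theorem ae_of_ae_ae_updateFinset (hP : MeasurableSet {x | P x}) (S : Finset V)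
    (h : ∀ᵐ x ∂Measure.pi μ, ∀ᵐ y ∂Measure.pi fun v : S => μ v,
      P (Function.updateFinset x S y)) :
    ∀ᵐ x ∂Measure.pi μ, P x := by
  have hsplit := measurePreserving_pi_of_prod (μ := μ) S
  rw [← hsplit.map_eq, ae_map_iff hsplit.aemeasurable hP]
  refine (Measure.ae_prod_iff_ae_ae (hsplit.measurable hP)).2 ?_
  filter_upwards [Measure.ae_ae_of_ae_prod (hsplit.quasiMeasurePreserving.ae h)] with w hw
  rcases (ae (Measure.pi fun v : S => μ v)).eq_or_neBot with hbot | hne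
  · simp only [hbot, Filter.eventually_bot]
  · obtain ⟨y', hy'⟩ := hw.exists
    filter_upwards [hy'] with y hy
    convert hy using 2 with v
    by_cases hv : v ∈ S <;> simp [Function.updateFinset, hv]

theorem lmarginal_congr_ae (h : f =ᵐ[Measure.pi μ] g) (S : Finset V) :
    lmarginal μ S f =ᵐ[Measure.pi μ] lmarginal μ S g := by
  filter_upwards [ae_ae_updateFinset h S] with x hx
  exact lintegral_congr_ae hx

theorem lmarginal_ne_zero_ae (hf : Measurable f) (h : ∀ᵐ x ∂Measure.pi μ, f x ≠ 0)
    (S : Finset V) : ∀ᵐ x ∂Measure.pi μ, lmarginal μ S f x ≠ 0 := by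
  refine ae_of_ae_ae_updateFinset (hf.lmarginal μ (measurableSet_singleton 0).compl) S ?_
  filter_upwards [ae_ae_updateFinset h S] with x hx
  simp only [apply_updateFinset_of_dependsOn_compl (dependsOn_lmarginal_compl S f)]
  by_cases h₀ : lmarginal μ S f x = 0
  · filter_upwards [hx, (lintegral_eq_zero_iff (hf.comp measurable_updateFinset)).1 h₀]
      with y hy hy₀ using absurd hy₀ hy
  · exact .of_forall fun _ => h₀

theorem ne_top_ae_of_lmarginal_ne_top_ae (hf : Measurable f)
    (h : ∀ᵐ x ∂Measure.pi μ, lmarginal μ S f x ≠ ∞) : ∀ᵐ x ∂Measure.pi μ, f x ≠ ∞ := by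
  refine ae_of_ae_ae_updateFinset (hf (measurableSet_singleton ∞).compl) S ?_
  filter_upwards [h] with x hx
  filter_upwards [ae_lt_top (hf.comp measurable_updateFinset) hx] with y hy using hy.ne

theorem lmarginal_ne_top_ae_of_subset (hf : Measurable f) (hST : S ⊆ T)
    (h : ∀ᵐ x ∂Measure.pi μ, lmarginal μ T f x ≠ ∞) :
    ∀ᵐ x ∂Measure.pi μ, lmarginal μ S f x ≠ ∞ := by
  rw [← lmarginal_lmarginal_sdiff hf hST] at h
  exact ne_top_ae_of_lmarginal_ne_top_ae (hf.lmarginal μ) h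

end Marginals

section ConditionalKernels

variable {V : Type*} [DecidableEq V] {X : V → Type*} [∀ v, MeasurableSpace (X v)]
  {μ : ∀ v, Measure (X v)} {R C : Finset V} {q : (∀ v, X v) → ℝ≥0∞} {v a b : V}

theorem measurable_kernelMargin [∀ v, SigmaFinite (μ v)] (hq : Measurable q) (T : Finset V) :
    Measurable (kernelMargin μ R q T) :=
  hq.lmarginal μ

theorem measurable_kernelCond [∀ v, SigmaFinite (μ v)] (hq : Measurable q) :
    Measurable (kernelCond μ R q v C) :=
  (hq.lmarginal μ).div (hq.lmarginal μ)

theorem dependsOn_kernelMargin {S T : Finset V} (hS : S ⊆ R \ T) :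
    DependsOn (kernelMargin μ R q T) (↑S : Set V)ᶜ :=
  (dependsOn_lmarginal_compl _ _).mono <| Set.compl_subset_compl.2 <| Finset.coe_subset.2 hS

theorem lmarginal_singleton_kernelMargin_insert [∀ v, SigmaFinite (μ v)] (hq : Measurable q)
    (hv : v ∈ R) (hvC : v ∉ C) :
    lmarginal μ {v} (kernelMargin μ R q (insert v C)) = kernelMargin μ R q C := by
  have hsub : R \ insert v C ⊆ R \ C :=
    Finset.sdiff_subset_sdiff subset_rfl (Finset.subset_insert _ _)
  have hsdiff : {v} = (R \ C) \ (R \ insert v C) := by grind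
  rw [kernelMargin, kernelMargin, hsdiff, lmarginal_lmarginal_sdiff hq hsub]

variable [Fintype V]

/-- An almost everywhere positive kernel `q(R | W)` with random variables `R`. Only finiteness of
the total mass over `R` is asked for, since this is what survives fixing. -/
structure IsPosKernel (μ : ∀ v, Measure (X v)) (R : Finset V) (q : (∀ v, X v) → ℝ≥0∞) :
    Prop where
  measurable : Measurable q
  ne_zero_ae : ∀ᵐ x ∂Measure.pi μ, q x ≠ 0
  lmarginal_ne_top_ae : ∀ᵐ x ∂Measure.pi μ, lmarginal μ R q x ≠ ∞

variable [∀ v, SigmaFinite (μ v)]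

theorem IsPosDensity.isPosKernel {p : (∀ v, X v) → ℝ≥0∞} (hp : IsPosDensity μ p) :
    IsPosKernel μ Finset.univ p where
  measurable := hp.measurable
  ne_zero_ae := hp.pos.mono fun _ => ne_of_gt
  lmarginal_ne_top_ae := .of_forall fun x => by
    rw [lmarginal_univ, hp.lintegral_eq_one]
    exact ENNReal.one_ne_top

namespace IsPosKernel

variable (h : IsPosKernel μ R q)

include h

theorem kernelMargin_ne_zero_ae (T : Finset V) :
    ∀ᵐ x ∂Measure.pi μ, kernelMargin μ R q T x ≠ 0 :=
  lmarginal_ne_zero_ae h.measurable h.ne_zero_ae _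

theorem kernelMargin_ne_top_ae (T : Finset V) :
    ∀ᵐ x ∂Measure.pi μ, kernelMargin μ R q T x ≠ ∞ :=
  lmarginal_ne_top_ae_of_subset h.measurable Finset.sdiff_subset h.lmarginal_ne_top_ae

theorem kernelCond_ne_zero_ae : ∀ᵐ x ∂Measure.pi μ, kernelCond μ R q v C x ≠ 0 := by
  filter_upwards [h.kernelMargin_ne_zero_ae (insert v C), h.kernelMargin_ne_top_ae C]
    with x hnum hden using ENNReal.div_ne_zero.2 ⟨hnum, hden⟩

theorem kernelCond_ne_top_ae : ∀ᵐ x ∂Measure.pi μ, kernelCond μ R q v C x ≠ ∞ := by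
  filter_upwards [h.kernelMargin_ne_zero_ae C, h.kernelMargin_ne_top_ae (insert v C)]
    with x hden hnum using ENNReal.div_ne_top hnum hden

theorem lmarginal_singleton_kernelCond (hv : v ∈ R) (hvC : v ∉ C) :
    lmarginal μ {v} (kernelCond μ R q v C) =ᵐ[Measure.pi μ] 1 := by
  have hdep : DependsOn (fun x => (kernelMargin μ R q C x)⁻¹) (↑({v} : Finset V) : Set V)ᶜ :=
    fun _ _ hxy => congrArg _ (dependsOn_kernelMargin (by grind) hxy)
  have hcond : kernelCond μ R q v C =
      fun x => (kernelMargin μ R q C x)⁻¹ * kernelMargin μ R q (insert v C) x :=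
    funext fun _ => ENNReal.div_eq_inv_mul
  rw [hcond, lmarginal_mul_of_dependsOn_compl hdep (measurable_kernelMargin h.measurable _),
    lmarginal_singleton_kernelMargin_insert h.measurable hv hvC]
  filter_upwards [h.kernelMargin_ne_zero_ae C, h.kernelMargin_ne_top_ae C]
    with x hzero htop using ENNReal.inv_mul_cancel hzero htop

theorem lmarginal_sdiff_insert_div_kernelCond :
    lmarginal μ (R \ insert v C) (fun x => q x / kernelCond μ R q v C x) =ᵐ[Measure.pi μ]
      kernelMargin μ R q C := by
  have hdep : DependsOn (fun x => (kernelCond μ R q v C x)⁻¹) (↑(R \ insert v C) : Set V)ᶜ := by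
    intro x y hxy
    simp only [kernelCond, dependsOn_kernelMargin subset_rfl hxy,
      dependsOn_kernelMargin (show R \ insert v C ⊆ R \ C by grind) hxy]
  simp only [ENNReal.div_eq_inv_mul]
  rw [lmarginal_mul_of_dependsOn_compl hdep h.measurable]
  filter_upwards [h.kernelMargin_ne_zero_ae (insert v C), h.kernelMargin_ne_top_ae (insert v C)]
    with x hzero htop
  change (kernelMargin μ R q (insert v C) x / kernelMargin μ R q C x)⁻¹ *
    kernelMargin μ R q (insert v C) x = _
  rw [ENNReal.inv_div (.inr htop) (.inr hzero), ENNReal.div_mul_cancel hzero htop]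

theorem lmarginal_erase_div_kernelCond (hvC : v ∉ C) :
    lmarginal μ (R.erase v) (fun x => q x / kernelCond μ R q v C x) =ᵐ[Measure.pi μ]
      lmarginal μ R q := by
  have hm : Measurable fun x => q x / kernelCond μ R q v C x :=
    h.measurable.div (measurable_kernelCond h.measurable)
  have hsub : R \ insert v C ⊆ R.erase v := by grind
  have hsdiff : R.erase v \ (R \ insert v C) = R \ (R \ C) := by grind
  rw [← lmarginal_lmarginal_sdiff hm hsub, hsdiff,
    ← lmarginal_lmarginal_sdiff h.measurable (Finset.sdiff_subset (s := R) (t := C))]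
  exact lmarginal_congr_ae h.lmarginal_sdiff_insert_div_kernelCond _

theorem div_kernelCond (hvC : v ∉ C) :
    IsPosKernel μ (R.erase v) fun x => q x / kernelCond μ R q v C x where
  measurable := h.measurable.div (measurable_kernelCond h.measurable)
  ne_zero_ae := by
    filter_upwards [h.ne_zero_ae, h.kernelCond_ne_top_ae (v := v) (C := C)]
      with x hzero htop using ENNReal.div_ne_zero.2 ⟨hzero, htop⟩
  lmarginal_ne_top_ae := by
    filter_upwards [h.lmarginal_erase_div_kernelCond hvC, h.lmarginal_ne_top_ae]
      with x heq htop using heq.trans_ne htop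

theorem lmarginal_singleton_ae_eq_of_div_kernelCond {g : (∀ v, X v) → ℝ≥0∞} (hv : v ∈ R)
    (hvC : v ∉ C) (hg : DependsOn g ({v} : Set V)ᶜ)
    (heq : (fun x => q x / kernelCond μ R q v C x) =ᵐ[Measure.pi μ] g) :
    lmarginal μ {v} q =ᵐ[Measure.pi μ] g := by
  have hq : q =ᵐ[Measure.pi μ] fun x => g x * kernelCond μ R q v C x := by
    filter_upwards [heq, h.kernelCond_ne_zero_ae (v := v) (C := C),
      h.kernelCond_ne_top_ae (v := v) (C := C)] with x hx hzero htop
    rw [← hx, ENNReal.div_mul_cancel hzero htop]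
  refine (lmarginal_congr_ae hq {v}).trans ?_
  rw [lmarginal_mul_of_dependsOn_compl (by simpa using hg) (measurable_kernelCond h.measurable)]
  filter_upwards [h.lmarginal_singleton_kernelCond hv hvC] with x hx
  rw [hx, Pi.one_apply, mul_one]

theorem kernelCond_ae_eq_of_kernelIndep (hab : KernelIndep μ R q a b C) :
    kernelCond μ R q a C =ᵐ[Measure.pi μ] kernelCond μ R q a (insert b C) := by
  filter_upwards [hab, h.kernelMargin_ne_zero_ae C, h.kernelMargin_ne_top_ae C,
    h.kernelMargin_ne_zero_ae (insert b C), h.kernelMargin_ne_top_ae (insert b C)]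
    with x hx hC hC' hbC hbC'
  rw [kernelCond, kernelCond, ENNReal.div_eq_div_iff hbC hbC' hC hC', mul_comm, ← hx, mul_comm]

end IsPosKernel

theorem KernelIndep.congr {q' : (∀ v, X v) → ℝ≥0∞} (hqq' : q =ᵐ[Measure.pi μ] q')
    (h : KernelIndep μ R q a b C) : KernelIndep μ R q' a b C := by
  have hmargin T : kernelMargin μ R q T =ᵐ[Measure.pi μ] kernelMargin μ R q' T :=
    lmarginal_congr_ae hqq' _
  filter_upwards [h, hmargin (insert a (insert b C)), hmargin C, hmargin (insert a C),
    hmargin (insert b C)] with x hx h₁ h₂ h₃ h₄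
  rwa [← h₁, ← h₂, ← h₃, ← h₄]

theorem kernelIndep_of_kernelMargin_ae_eq_mul {f g : (∀ v, X v) → ℝ≥0∞} (hq : Measurable q)
    (ha : a ∈ R) (hb : b ∈ R) (hab : a ≠ b) (haC : a ∉ C) (hbC : b ∉ C)
    (hf : Measurable f) (hg : Measurable g) (hfb : DependsOn f ({b} : Set V)ᶜ)
    (hga : DependsOn g ({a} : Set V)ᶜ)
    (hfg : kernelMargin μ R q (insert a (insert b C)) =ᵐ[Measure.pi μ] fun x => f x * g x) :
    KernelIndep μ R q a b C := by
  rw [← Finset.coe_singleton] at hfb hga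
  have haC_margin : kernelMargin μ R q (insert a C) =ᵐ[Measure.pi μ]
      fun x => f x * lmarginal μ {b} g x := by
    rw [← lmarginal_mul_of_dependsOn_compl hfb hg,
      ← lmarginal_singleton_kernelMargin_insert hq hb (by grind : b ∉ insert a C),
      Finset.insert_comm]
    exact lmarginal_congr_ae hfg _
  have hbC_margin : kernelMargin μ R q (insert b C) =ᵐ[Measure.pi μ]
      fun x => g x * lmarginal μ {a} f x := by
    rw [← lmarginal_mul_of_dependsOn_compl hga hf,
      ← lmarginal_singleton_kernelMargin_insert hq ha (by grind : a ∉ insert b C)]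
    simp only [mul_comm (g _)]
    exact lmarginal_congr_ae hfg _
  have hC_margin : kernelMargin μ R q C =ᵐ[Measure.pi μ]
      fun x => lmarginal μ {b} g x * lmarginal μ {a} f x := by
    rw [← lmarginal_mul_of_dependsOn_compl (dependsOn_lmarginal hga {b}) hf,
      ← lmarginal_singleton_kernelMargin_insert hq ha haC]
    simp only [mul_comm (lmarginal μ {b} g _)]
    exact lmarginal_congr_ae haC_margin _
  filter_upwards [hfg, haC_margin, hbC_margin, hC_margin] with x h₁ h₂ h₃ h₄
  rw [h₁, h₂, h₃, h₄]
  ring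

theorem kernelIndep_of_kernelMargin_ae_eq_prod {𝒟 : Finset (Finset V)} {P : Finset V → Finset V}
    {k : Finset V → (∀ v, X v) → ℝ≥0∞} (hq : Measurable q)
    (ha : a ∈ R) (hb : b ∈ R) (hab : a ≠ b) (haC : a ∉ C) (hbC : b ∉ C)
    (hk : ∀ D ∈ 𝒟, IsKernel μ D (P D) (k D))
    (hsep : ∀ D ∈ 𝒟, a ∈ D ∪ P D → b ∉ D ∪ P D)
    (hprod : kernelMargin μ R q (insert a (insert b C)) =ᵐ[Measure.pi μ]
      fun x => ∏ D ∈ 𝒟, k D x) :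
    KernelIndep μ R q a b C := by
  have hdep : ∀ D ∈ 𝒟, ∀ u, u ∉ D ∪ P D → DependsOn (k D) ({u} : Set V)ᶜ := fun D hD u hu =>
    (hk D hD).dependsOn.mono <| Set.subset_compl_singleton_iff.2 hu
  refine kernelIndep_of_kernelMargin_ae_eq_mul hq ha hb hab haC hbC
    (f := fun x => ∏ D ∈ 𝒟 with a ∈ D ∪ P D, k D x)
    (g := fun x => ∏ D ∈ 𝒟 with a ∉ D ∪ P D, k D x)
    (Finset.measurable_prod _ fun D hD => (hk D (Finset.mem_filter.1 hD).1).measurable)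
    (Finset.measurable_prod _ fun D hD => (hk D (Finset.mem_filter.1 hD).1).measurable)
    (dependsOn_finsetProd _ fun D hD => ?_) (dependsOn_finsetProd _ fun D hD => ?_)
    (by simpa only [Finset.prod_filter_mul_prod_filter_not] using hprod)
  · obtain ⟨hD, haD⟩ := Finset.mem_filter.1 hD
    exact hdep D hD b (hsep D hD haD)
  · obtain ⟨hD, haD⟩ := Finset.mem_filter.1 hD
    exact hdep D hD a haD

end ConditionalKernels

namespace CADMG

section Fixing

variable {V : Type*}

theorem fixable_of_childless {G : CADMG V} {v : V} (hv : v ∈ G.rand) (h : ∀ u, ¬ G.dir v u) :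
    G.Fixable v := by
  refine ⟨hv, fun u _ _ hu => ?_⟩
  obtain ⟨w, hvw, -⟩ := Relation.TransGen.head'_iff.1 hu.1
  exact h w hvw

variable [DecidableEq V]

theorem fixSet_fixSet (G : CADMG V) (S T : Finset V) :
    (G.fixSet S).fixSet T = G.fixSet (S ∪ T) := by
  simp only [fixSet, CADMG.mk.injEq, sdiff_sdiff_left, Finset.sup_eq_union, true_and]
  constructor <;> ext u v <;> simp only [Finset.mem_union] <;> tauto

theorem fixSet_empty (G : CADMG V) : G.fixSet ∅ = G := by
  cases G
  simp [fixSet]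

theorem fixSeq_eq_fixSet (G : CADMG V) (l : List V) : G.fixSeq l = G.fixSet l.toFinset := by
  induction l generalizing G with
  | nil => simp [fixSeq, fixSet_empty]
  | cons v _ ih => rw [fixSeq, ih, fixSet_fixSet, List.toFinset_cons, Finset.insert_eq]

theorem rand_fixSeq (G : CADMG V) (l : List V) : (G.fixSeq l).rand = G.rand \ l.toFinset := by
  rw [fixSeq_eq_fixSet]
  rfl

theorem fixSeq_append (G : CADMG V) (l l' : List V) :
    G.fixSeq (l ++ l') = (G.fixSeq l).fixSeq l' := by
  simp only [fixSeq_eq_fixSet, fixSet_fixSet, List.toFinset_append]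

theorem validFixing_append {G : CADMG V} {l l' : List V} :
    G.ValidFixing (l ++ l') ↔ G.ValidFixing l ∧ (G.fixSeq l).ValidFixing l' := by
  induction l generalizing G with
  | nil => simp [ValidFixing, fixSeq]
  | cons v _ ih => simp only [List.cons_append, ValidFixing, fixSeq, ih, and_assoc]

theorem ValidFixing.exists_fixable {G : CADMG V} {l : List V} (hl : G.ValidFixing l) {v : V}
    (hv : v ∈ l) : ∃ S ⊆ l.toFinset, (G.fixSet S).Fixable v := by
  obtain ⟨l₁, l₂, rfl⟩ := List.append_of_mem hv
  refine ⟨l₁.toFinset, fun u hu => by simp_all, ?_⟩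
  rw [← fixSeq_eq_fixSet]
  exact (validFixing_append.1 hl).2.1

end Fixing

section Districts

variable {V : Type*} {G : CADMG V} {D T : Finset V} {u v m y : V}

theorem mem_district : u ∈ G.district v ↔ u ∈ G.rand ∧ Relation.ReflTransGen G.bi v u := by
  simp [district]

theorem mem_district_self (hv : v ∈ G.rand) : v ∈ G.district v :=
  mem_district.2 ⟨hv, .refl⟩

theorem mem_parents [Fintype V] : u ∈ G.parents D ↔ ∃ v ∈ D, G.dir u v := by
  simp [parents]

theorem reflTransGen_bi_symm (h : Relation.ReflTransGen G.bi u v) :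
    Relation.ReflTransGen G.bi v u :=
  have : Std.Symm G.bi := ⟨G.bi_symm⟩
  Relation.ReflTransGen.stdSymm.symm _ _ h

theorem transGen_bi_symm (h : Relation.TransGen G.bi u v) : Relation.TransGen G.bi v u :=
  have : Std.Symm G.bi := ⟨G.bi_symm⟩
  Relation.TransGen.stdSymm.symm _ _ h

theorem exists_mem_forall_not_transGen_dir [Finite V] (G : CADMG V) (hT : T.Nonempty) :
    ∃ v ∈ T, ∀ u ∈ T, ¬ Relation.TransGen G.dir v u := by
  have : IsStrictOrder V fun u v => Relation.TransGen G.dir v u :=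
    { irrefl := G.acyclic
      trans := fun _ _ _ h₁ h₂ => h₂.trans h₁ }
  exact (Finite.wellFounded_of_trans_of_irrefl
    fun u v => Relation.TransGen G.dir v u).has_min (↑T : Set V) hT

variable [DecidableEq V]

theorem parents_fixSet_of_disjoint [Fintype V] {S : Finset V} (h : Disjoint S D) :
    (G.fixSet S).parents D = G.parents D := by
  ext u
  simp only [mem_parents, fixSet]
  exact exists_congr fun v => and_congr_right fun hv =>
    and_iff_left (Finset.disjoint_right.1 h hv)

theorem reflTransGen_bi_of_mem_districts (hD : D ∈ G.districts) (hu : u ∈ D) (hv : v ∈ D) :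
    Relation.ReflTransGen G.bi u v := by
  obtain ⟨w, -, rfl⟩ := Finset.mem_image.1 hD
  exact (reflTransGen_bi_symm (mem_district.1 hu).2).trans (mem_district.1 hv).2

theorem subset_rand_of_mem_districts (hD : D ∈ G.districts) : D ⊆ G.rand := by
  obtain ⟨w, -, rfl⟩ := Finset.mem_image.1 hD
  exact fun u hu => (mem_district.1 hu).1

theorem mem_of_reflTransGen_bi (hD : D ∈ G.districts) (hu : u ∈ D)
    (h : Relation.ReflTransGen G.bi u v) : v ∈ D := by
  induction h with
  | refl => exact hu
  | tail _ hbc ih =>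
    obtain ⟨w, -, rfl⟩ := Finset.mem_image.1 hD
    exact mem_district.2 ⟨G.bi_rand _ _ (G.bi_symm _ _ hbc), (mem_district.1 ih).2.tail hbc⟩

theorem district_mem_districts (hv : v ∈ G.rand) : G.district v ∈ G.districts :=
  Finset.mem_image_of_mem _ hv

theorem district_eq_of_mem (hD : D ∈ G.districts) (hu : u ∈ D) : G.district u = D := by
  ext v
  rw [mem_district]
  exact ⟨fun h => mem_of_reflTransGen_bi hD hu h.2,
    fun h => ⟨subset_rand_of_mem_districts hD h, reflTransGen_bi_of_mem_districts hD hu h⟩⟩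

theorem nonempty_of_mem_districts (hD : D ∈ G.districts) : D.Nonempty := by
  obtain ⟨w, hw, rfl⟩ := Finset.mem_image.1 hD
  exact ⟨w, mem_district_self hw⟩

theorem districts_eq_singleton (hD : D ∈ G.districts) (hrand : G.rand ⊆ D) :
    G.districts = {D} := by
  refine Finset.eq_singleton_iff_unique_mem.2 ⟨hD, fun D' hD' => ?_⟩
  obtain ⟨w, hw⟩ := nonempty_of_mem_districts hD'
  rw [← district_eq_of_mem hD (hrand (subset_rand_of_mem_districts hD' hw)),
    district_eq_of_mem hD' hw]

theorem mem_districts_fixSet {S : Finset V} (hD : D ∈ G.districts) (hS : Disjoint S D) :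
    D ∈ (G.fixSet S).districts := by
  obtain ⟨w, hw⟩ := nonempty_of_mem_districts hD
  have hrand : ∀ u ∈ D, u ∈ (G.fixSet S).rand := fun u hu => Finset.mem_sdiff.2
    ⟨subset_rand_of_mem_districts hD hu, Finset.disjoint_right.1 hS hu⟩
  have hconn : ∀ u, Relation.ReflTransGen G.bi w u → Relation.ReflTransGen (G.fixSet S).bi w u := by
    intro u hu
    induction hu with
    | refl => exact .refl
    | tail hwb hbc ih =>
      exact ih.tail ⟨hbc, Finset.disjoint_right.1 hS (mem_of_reflTransGen_bi hD hw hwb),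
        Finset.disjoint_right.1 hS (mem_of_reflTransGen_bi hD hw (hwb.tail hbc))⟩
  suffices hdistrict : (G.fixSet S).district w = D from
    hdistrict ▸ district_mem_districts (hrand w hw)
  ext u
  rw [mem_district]
  exact ⟨fun h => mem_of_reflTransGen_bi hD hw (.mono (fun _ _ h => h.1) _ _ h.2),
    fun h => ⟨hrand u h, hconn u (reflTransGen_bi_of_mem_districts hD hw h)⟩⟩

theorem exists_validFixing_of_mem_districts [Finite V] (hD : D ∈ G.districts) :
    ∃ l, G.ValidFixing l ∧ l.toFinset = G.rand \ D ∧ (G.fixSeq l).districts = {D} := by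
  induction hn : (G.rand \ D).card generalizing G with
  | zero =>
    have hempty := Finset.card_eq_zero.1 hn
    exact ⟨[], trivial, hempty.symm,
      districts_eq_singleton hD (Finset.sdiff_eq_empty_iff_subset.1 hempty)⟩
  | succ n ih =>
    obtain ⟨v, hv, hmax⟩ := G.exists_mem_forall_not_transGen_dir (T := G.rand \ D)
      (Finset.card_pos.1 (by omega))
    obtain ⟨hvR, hvD⟩ := Finset.mem_sdiff.1 hv
    have hfix : G.Fixable v := ⟨hvR, fun u hu _ huv => by
      by_cases huD : u ∈ D
      · exact hvD (mem_of_reflTransGen_bi hD huD (reflTransGen_bi_symm huv.2.to_reflTransGen))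
      · exact hmax u (Finset.mem_sdiff.2 ⟨hu, huD⟩) huv.1⟩
    have hrand : (G.fixSet {v}).rand \ D = (G.rand \ D).erase v := by
      rw [← Finset.sdiff_singleton_eq_erase, sdiff_right_comm]
      rfl
    obtain ⟨l, hl, hlD, hld⟩ := ih (mem_districts_fixSet hD (Finset.disjoint_singleton_left.2 hvD))
      (by rw [hrand, Finset.card_erase_of_mem hv, hn, Nat.add_sub_cancel])
    refine ⟨v :: l, ⟨hfix, hl⟩, ?_, hld⟩
    rw [List.toFinset_cons, hlD, hrand, Finset.insert_erase hv]

theorem exists_bi_reflTransGen_fixSet (h : Relation.TransGen G.bi m y) (hmy : m ≠ y) :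
    ∃ b, G.bi m b ∧ Relation.ReflTransGen (G.fixSet {m}).bi b y := by
  induction h with
  | single hy => exact ⟨_, hy, .refl⟩
  | @tail c y _ hcy ih =>
    rcases eq_or_ne m c with rfl | hmc
    · exact ⟨y, hcy, .refl⟩
    · obtain ⟨b, hmb, hbc⟩ := ih hmc
      exact ⟨b, hmb, hbc.tail
        ⟨hcy, by simpa using hmc.symm, by simpa using hmy.symm⟩⟩

variable [Fintype V]

theorem intrinsic_of_mem_districts (hG : G.IsADMG) {l : List V} (hl : G.ValidFixing l)
    (hD : D ∈ (G.fixSeq l).districts) : G.Intrinsic D := by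
  obtain ⟨l', hl', hl'D, hdistricts⟩ := exists_validFixing_of_mem_districts hD
  refine ⟨l ++ l', validFixing_append.2 ⟨hl, hl'⟩, ?_, by rw [fixSeq_append, hdistricts]⟩
  have hDl := subset_rand_of_mem_districts hD
  rw [rand_fixSeq, hG] at hDl hl'D
  rw [List.toFinset_append, hl'D]
  grind

theorem Identified.not_transGen_bi (h : G.Identified {m}) (hmy : G.dir m y) :
    ¬ Relation.TransGen G.bi m y := by
  intro hbi
  have hne : m ≠ y := by
    rintro rfl
    exact G.acyclic m (.single hmy)
  obtain ⟨b, hmb, hby⟩ := exists_bi_reflTransGen_fixSet hbi hne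
  have hy : y ∈ (G.fixSet {m}).rand :=
    Finset.mem_sdiff.2 ⟨G.dir_rand _ _ hmy, by simpa using hne.symm⟩
  set D := (G.fixSet {m}).district y
  have hD : D ∈ (G.fixSet {m}).districts := district_mem_districts hy
  have hyD : y ∈ D := mem_district_self hy
  have hbD : b ∈ D := mem_of_reflTransGen_bi hD hyD (reflTransGen_bi_symm hby)
  have hmD : m ∉ D := fun hm => by
    simpa [fixSet] using subset_rand_of_mem_districts hD hm
  obtain ⟨l, hl, hlD, -⟩ := h D hD
  obtain ⟨S, hSl, hfix⟩ := hl.exists_fixable (v := m) (List.mem_toFinset.1 (by simp [hlD, hmD]))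
  have hSD : Disjoint S D := Finset.disjoint_of_subset_left (hlD ▸ hSl) Finset.sdiff_disjoint
  have hyS : y ∉ S := Finset.disjoint_right.1 hSD hyD
  have hby' : Relation.ReflTransGen (G.fixSet S).bi b y := by
    have := reflTransGen_bi_of_mem_districts (mem_districts_fixSet hD hSD) hbD hyD
    exact .mono (fun _ _ h => ⟨h.1.1, h.2⟩) _ _ this
  exact hfix.2 y (Finset.mem_sdiff.2 ⟨G.dir_rand _ _ hmy, hyS⟩) hne.symm
    ⟨.single ⟨hmy, hyS⟩,
      .head' ⟨hmb, (Finset.mem_sdiff.1 hfix.1).2, Finset.disjoint_right.1 hSD hbD⟩ hby'⟩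

theorem notMem_mb (G : CADMG V) (v : V) : v ∉ G.mb v := Finset.notMem_erase _ _

theorem mem_mb : u ∈ G.mb v ↔ u ≠ v ∧ (u ∈ G.district v ∨ ∃ w ∈ G.district v, G.dir u w) := by
  simp [mb, mem_parents]

end Districts

end CADMG

namespace CADMG

section MSeparation

variable {V : Type*} {G : CADMG V} {B C : Finset V} {x y u v w a b : V} {k k₁ k₂ : EdgeKind}
  {l : List (EdgeKind × V)}

/-- A set of vertices is ancestral if it contains the parents of its members. -/
def IsAncestral (G : CADMG V) (B : Finset V) : Prop :=
  ∀ u v, G.dir u v → v ∈ B → u ∈ B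

theorem IsAncestral.mem_of_reflTransGen (hB : G.IsAncestral B)
    (h : Relation.ReflTransGen G.dir u v) (hv : v ∈ B) : u ∈ B := by
  induction h using Relation.ReflTransGen.head_induction_on with
  | refl => exact hv
  | head huw _ ih => exact hB _ _ huw ih

theorem OpenWalk.hasEdge (h : G.OpenWalk C x ((k, v) :: l)) : G.HasEdge x k v := by
  cases l with
  | nil => exact h
  | cons => exact h.1

theorem OpenWalk.tail (h : G.OpenWalk C x ((k, v) :: l)) : G.OpenWalk C v l := by
  cases l with
  | nil => trivial
  | cons => exact h.2.2.2

theorem OpenWalk.exists_ancestor (h : G.OpenWalk C x ((.fwd, v) :: l))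
    (hlast : (v :: l.map Prod.snd).getLast? = some y) :
    ∃ c, (c = y ∨ c ∈ C) ∧ Relation.ReflTransGen G.dir x c := by
  induction l generalizing x v with
  | nil => exact ⟨v, .inl (by simpa using hlast), .single h⟩
  | cons e l ih =>
    obtain ⟨k, w⟩ := e
    by_cases hk : k.headAtStart
    · obtain ⟨c, hc, hvc⟩ := h.2.1 ⟨trivial, hk⟩
      exact ⟨c, .inr hc, .head h.1 hvc⟩
    · cases k
      · obtain ⟨c, hc, hvc⟩ := ih h.tail (by simpa using hlast)
        exact ⟨c, hc, .head h.1 hvc⟩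
      · exact absurd trivial hk
      · exact absurd trivial hk

theorem not_mSep_of_openWalk (hxy : x ≠ y) (hnodup : (x :: l.map Prod.snd).Nodup)
    (hlast : (x :: l.map Prod.snd).getLast? = some y) (hopen : G.OpenWalk C x l) :
    ¬ G.MSep x y C := by
  have hne : l.map Prod.snd ≠ [] := fun hnil => hxy (by simpa [hnil] using hlast)
  exact fun hsep => hsep ⟨l, hne, by rwa [List.getLast?_cons_of_ne_nil hne] at hlast, hnodup, hopen⟩

theorem not_mSep_of_edge (hxy : x ≠ y) (h : G.HasEdge x k y) : ¬ G.MSep x y C :=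
  not_mSep_of_openWalk (l := [(k, y)]) hxy (by simpa using hxy) (by simp) h

theorem not_mSep_of_nonCollider (hxvy : [x, v, y].Nodup) (h₁ : G.HasEdge x k₁ v)
    (h₂ : G.HasEdge v k₂ y) (hk : ¬ (k₁.headAtEnd ∧ k₂.headAtStart)) (hv : v ∉ C) :
    ¬ G.MSep x y C :=
  not_mSep_of_openWalk (l := [(k₁, v), (k₂, y)]) (by grind) hxvy (by simp)
    ⟨h₁, fun hc => absurd hc hk, fun _ => hv, h₂⟩

theorem not_mSep_of_collider (hxvy : [x, v, y].Nodup) (h₁ : G.HasEdge x k₁ v)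
    (h₂ : G.HasEdge v k₂ y) (hk : k₁.headAtEnd ∧ k₂.headAtStart) (hv : v ∈ C) :
    ¬ G.MSep x y C :=
  not_mSep_of_openWalk (l := [(k₁, v), (k₂, y)]) (by grind) hxvy (by simp)
    ⟨h₁, fun _ => ⟨v, hv, .refl⟩, fun hc => absurd hk hc, h₂⟩

/-- `l` is an open path from `x` to `y` given `C` that stays one when an edge into `x` is prepended:
its edges have an arrowhead where they start, so that all inner vertices are then colliders. -/
structure IsColliderPath (G : CADMG V) (C : Finset V) (x y : V) (l : List (EdgeKind × V)) :
    Prop where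
  nodup : (x :: l.map Prod.snd).Nodup
  getLast? : (x :: l.map Prod.snd).getLast? = some y
  openWalk : G.OpenWalk C x l
  headAtStart : ∀ e ∈ l, e.1.headAtStart

theorem IsColliderPath.exists_suffix (h : G.IsColliderPath C x y l)
    (hu : u ∈ x :: l.map Prod.snd) : ∃ l', G.IsColliderPath C u y l' := by
  induction l generalizing x with
  | nil =>
    obtain rfl : u = x := by simpa using hu
    exact ⟨[], h⟩
  | cons e l ih =>
    rcases List.mem_cons.1 hu with rfl | hu
    · exact ⟨e :: l, h⟩
    · refine ih ⟨(List.nodup_cons.1 h.nodup).2, by simpa using h.getLast?, h.openWalk.tail,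
        fun e' he' => h.headAtStart e' (List.mem_cons_of_mem _ he')⟩ hu

variable [DecidableEq V]

theorem OpenWalk.of_fixSet {S : Finset V} (h : (G.fixSet S).OpenWalk (C ∪ S) x l) :
    G.OpenWalk C x l := by
  have hedge : ∀ {x k v}, (G.fixSet S).HasEdge x k v → G.HasEdge x k v := by
    rintro x (_ | _ | _) v hxv <;> exact hxv.1
  have hhead : ∀ {x k v}, (G.fixSet S).HasEdge x k v → k.headAtEnd → v ∉ S := by
    rintro x (_ | _ | _) v hxv hk
    exacts [hxv.2, hk.elim, hxv.2.2]
  have hancestor : ∀ {v c}, v ∉ S → c ∈ C ∪ S → Relation.ReflTransGen (G.fixSet S).dir v c →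
      c ∈ C ∧ Relation.ReflTransGen G.dir v c := by
    intro v c hv hc hvc
    refine ⟨(Finset.mem_union.1 hc).resolve_right ?_, .mono (fun _ _ h => h.1) _ _ hvc⟩
    rcases hvc.cases_tail with rfl | ⟨w, -, hwc⟩
    exacts [hv, hwc.2]
  induction l generalizing x with
  | nil => trivial
  | cons e l ih =>
    obtain ⟨k, v⟩ := e
    cases l with
    | nil => exact hedge h
    | cons e' l =>
      refine ⟨hedge h.1, fun hcollider => ?_, fun hnon hv => ?_, ih h.2.2.2⟩
      · obtain ⟨c, hc, hvc⟩ := h.2.1 hcollider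
        exact ⟨c, hancestor (hhead h.1 hcollider.1) hc hvc⟩
      · exact h.2.2.1 hnon (Finset.mem_union_left _ hv)

theorem MSep.fixSet (h : G.MSep x y C) (S : Finset V) : (G.fixSet S).MSep x y (C ∪ S) :=
  fun ⟨l, hne, hlast, hnodup, hopen⟩ => h ⟨l, hne, hlast, hnodup, hopen.of_fixSet⟩

theorem OpenWalk.collider_of_isAncestral (hanc : G.IsAncestral (insert a (insert b C)))
    (h : G.OpenWalk C x ((k₁, v) :: (k₂, w) :: l))
    (hlast : (w :: l.map Prod.snd).getLast? = some b) (hva : v ≠ a) (hvb : v ≠ b)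
    (hk₁ : k₁.headAtEnd) : v ∈ C ∧ k₂.headAtStart := by
  have hmem : ∀ {c}, (c = b ∨ c ∈ C) → Relation.ReflTransGen G.dir v c → v ∈ C := fun hc hvc => by
    simpa [hva, hvb] using hanc.mem_of_reflTransGen hvc (by simp [hc])
  by_cases hk₂ : k₂.headAtStart
  · obtain ⟨c, hc, hvc⟩ := h.2.1 ⟨hk₁, hk₂⟩
    exact ⟨hmem (.inr hc) hvc, hk₂⟩
  · obtain rfl : k₂ = .fwd := by
      cases k₂
      exacts [rfl, (hk₂ trivial).elim, (hk₂ trivial).elim]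
    obtain ⟨c, hc, hvc⟩ := h.tail.exists_ancestor hlast
    exact absurd (hmem hc hvc) (h.2.2.1 fun hcollider => hk₂ hcollider.2)

theorem OpenWalk.mem_and_headAtEnd {S : Set V} (hanc : G.IsAncestral (insert x (insert y C)))
    (hdir : ∀ v, G.dir x v → v ∈ S) (hdir_y : ¬ G.dir y u) (hbi : ∀ v, G.bi u v → v ∈ S)
    (hu : u ∈ insert x C) (h : G.OpenWalk C u ((k, v) :: l))
    (hlast : (v :: l.map Prod.snd).getLast? = some y) (hvx : v ≠ x)
    (hhead : u = x ∨ k.headAtStart) : v ∈ S ∧ k.headAtEnd := by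
  cases k with
  | fwd =>
    obtain rfl := hhead.resolve_right id
    exact ⟨hdir v h.hasEdge, trivial⟩
  | bidir => exact ⟨hbi v h.hasEdge, trivial⟩
  | bwd =>
    have hvu : G.dir v u := h.hasEdge
    have hvy : v ≠ y := by
      rintro rfl
      exact hdir_y hvu
    have hvC : v ∈ C := by
      simpa [hvx, hvy] using hanc v u hvu (Finset.insert_subset_insert x (by simp) hu)
    cases l with
    | nil => exact absurd (by simpa using hlast) hvy
    | cons => exact absurd hvC (h.2.2.1 And.left)

-- All inner vertices of an open path inside an ancestral set are colliders, so that the path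
-- leaves `x` along `→` or `↔`, and continues along bidirected edges between vertices of `C`.
theorem mSep_of_isAncestral (S : Set V) (hanc : G.IsAncestral (insert x (insert y C)))
    (hxS : x ∈ S) (hyS : y ∉ S) (hdir : ∀ v, G.dir x v → v ∈ S)
    (hdir_y : ∀ u ∈ insert x C, u ∈ S → ¬ G.dir y u)
    (hbi : ∀ u ∈ insert x C, u ∈ S → ∀ v, G.bi u v → v ∈ S) : G.MSep x y C := by
  suffices h : ∀ (l : List (EdgeKind × V)) (u : V), u ∈ insert x C → u ∈ S →
      (u :: l.map Prod.snd).getLast? = some y → (l.map Prod.snd).Nodup → x ∉ l.map Prod.snd →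
      G.OpenWalk C u l → (∀ e ∈ l.head?, u = x ∨ e.1.headAtStart) → False by
    rintro ⟨l, hne, hlast, hnodup, hopen⟩
    obtain ⟨hx, hnodup⟩ := List.nodup_cons.1 hnodup
    exact h l x (Finset.mem_insert_self _ _) hxS
      (by rwa [List.getLast?_cons_of_ne_nil hne]) hnodup hx hopen fun _ _ => .inl rfl
  intro l
  induction l with
  | nil =>
    intro u _ huS hlast
    obtain rfl : u = y := by simpa using hlast
    exact fun _ _ _ _ => hyS huS
  | cons e l ih =>
    obtain ⟨k, v⟩ := e
    intro u hu huS hlast hnodup hx hopen hhead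
    simp only [List.map_cons, List.getLast?_cons_cons, List.mem_cons, not_or] at hlast hnodup hx
    obtain ⟨hvS, hk⟩ := hopen.mem_and_headAtEnd hanc hdir (hdir_y u hu huS) (hbi u hu huS) hu hlast
      (Ne.symm hx.1) (hhead _ rfl)
    cases l with
    | nil =>
      obtain rfl : v = y := by simpa using hlast
      exact hyS hvS
    | cons e' l =>
      obtain ⟨k', w⟩ := e'
      have hvy : v ≠ y := by
        rintro rfl
        exact (List.nodup_cons.1 hnodup).1
          (List.mem_of_getLast?
            (by simpa only [List.map_cons, List.getLast?_cons_cons] using hlast))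
      obtain ⟨hvC, hk'⟩ := hopen.collider_of_isAncestral hanc
        (by simpa only [List.map_cons, List.getLast?_cons_cons] using hlast) (Ne.symm hx.1) hvy hk
      refine ih v (Finset.mem_insert_of_mem hvC) hvS hlast (List.nodup_cons.1 hnodup).2 hx.2
        hopen.tail fun e he => .inr ?_
      obtain rfl : (k', w) = e := by simpa using he
      exact hk'

theorem mSep_of_forall_not_bi (hanc : G.IsAncestral (insert x (insert y C))) (hxy : x ≠ y)
    (hdir : ¬ G.dir x y) (hdir_y : ∀ u ∈ insert x C, ¬ G.dir y u)
    (hbi : ∀ u ∈ insert x C, ¬ G.bi u y) : G.MSep x y C :=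
  mSep_of_isAncestral {y}ᶜ hanc hxy (fun hy => hy rfl) (fun _ hv hvy => hdir (hvy ▸ hv))
    (fun u hu _ => hdir_y u hu) fun u hu _ _ huv hvy => hbi u hu (hvy ▸ huv)

variable [Fintype V]

theorem IsColliderPath.openWalk_cons (hl : G.IsColliderPath (Finset.univ \ {a, b}) u b l)
    (hua : u ≠ a) (hxu : G.HasEdge x k u) (hk : k.headAtEnd) :
    G.OpenWalk (Finset.univ \ {a, b}) x ((k, u) :: l) := by
  cases l with
  | nil => exact hxu
  | cons e l =>
    have hub : u ≠ b := by
      rintro rfl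
      have hlast := hl.getLast?
      rw [List.map_cons, List.getLast?_cons_cons] at hlast
      exact (List.nodup_cons.1 hl.nodup).1 (List.mem_of_getLast? hlast)
    refine ⟨hxu, fun _ => ⟨u, by simp [hua, hub], .refl⟩,
      fun hnon => absurd ⟨hk, hl.headAtStart e (List.mem_cons_self ..)⟩ hnon, hl.openWalk⟩

theorem MSep.exists_isColliderPath (hab : a ≠ b) (h : G.MSep a b (Finset.univ \ {a, b}))
    (hbi : Relation.ReflTransGen G.bi u w) (hw : w = b ∨ G.dir b w) :
    ∃ l, G.IsColliderPath (Finset.univ \ {a, b}) u b l := by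
  induction hbi using Relation.ReflTransGen.head_induction_on with
  | refl =>
    rcases hw with rfl | hbw
    · exact ⟨[], by simp, by simp, trivial, by simp⟩
    · have hne : w ≠ b := fun hwb => G.acyclic b (.single (hwb ▸ hbw))
      exact ⟨[(.bwd, b)], by simpa using hne, by simp, hbw, by simp [EdgeKind.headAtStart]⟩
  | @head u u' huu' _ ih =>
    obtain ⟨l, hl⟩ := ih
    by_cases hu : u ∈ u' :: l.map Prod.snd
    · exact hl.exists_suffix hu
    · have hu'a : u' ≠ a := by
        rintro rfl
        exact not_mSep_of_openWalk hab hl.nodup hl.getLast? hl.openWalk h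
      refine ⟨(.bidir, u') :: l, List.nodup_cons.2 ⟨hu, hl.nodup⟩, by simpa using hl.getLast?,
        hl.openWalk_cons hu'a huu' trivial, ?_⟩
      simpa [EdgeKind.headAtStart] using hl.headAtStart

theorem not_mSep_of_mem_districts {D : Finset V} (hD : D ∈ G.districts) (hab : a ≠ b)
    (ha : a ∈ D ∪ G.parents D) (hb : b ∈ D ∪ G.parents D) :
    ¬ G.MSep a b (Finset.univ \ {a, b}) := by
  intro h
  have hmem : ∀ {c}, c ∈ D ∪ G.parents D → ∃ u ∈ D, u = c ∨ G.dir c u := fun hc => by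
    rcases Finset.mem_union.1 hc with hc | hc
    · exact ⟨_, hc, .inl rfl⟩
    · obtain ⟨u, hu, hcu⟩ := mem_parents.1 hc
      exact ⟨u, hu, .inr hcu⟩
  obtain ⟨u, hu, hau⟩ := hmem ha
  obtain ⟨w, hw, hbw⟩ := hmem hb
  obtain ⟨l, hl⟩ := h.exists_isColliderPath hab (reflTransGen_bi_of_mem_districts hD hu hw) hbw
  by_cases hmem_a : a ∈ u :: l.map Prod.snd
  · obtain ⟨l', hl'⟩ := hl.exists_suffix hmem_a
    exact not_mSep_of_openWalk hab hl'.nodup hl'.getLast? hl'.openWalk h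
  · have hua : u ≠ a := fun hua => hmem_a (by simp [hua])
    refine not_mSep_of_openWalk (l := (.fwd, u) :: l) hab (List.nodup_cons.2 ⟨hmem_a, hl.nodup⟩)
      (by simpa using hl.getLast?) ?_ h
    exact hl.openWalk_cons hua (hau.resolve_left hua) trivial

end MSeparation

end CADMG

section NestedMarkovModels

variable {V : Type*} [Fintype V] [DecidableEq V] {X : V → Type*} [∀ v, MeasurableSpace (X v)]
  {μ : ∀ v, Measure (X v)} {p q : (∀ v, X v) → ℝ≥0∞} {G : CADMG V} {C T : Finset V} {v a b : V}
  {l : List V}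

theorem fixKernel_append_singleton (G : CADMG V) (l : List V) (v : V) (q : (∀ v, X v) → ℝ≥0∞) :
    fixKernel μ G (l ++ [v]) q = fun x => fixKernel μ G l q x /
      kernelCond μ (G.fixSeq l).rand (fixKernel μ G l q) v ((G.fixSeq l).mb v) x := by
  induction l generalizing G q with
  | nil => rfl
  | cons _ _ ih => exact ih _ _

variable [∀ v, SigmaFinite (μ v)]

theorem isPosKernel_fixKernel (h : IsPosKernel μ G.rand q) (l : List V) :
    IsPosKernel μ (G.fixSeq l).rand (fixKernel μ G l q) := by
  induction l generalizing G q with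
  | nil => exact h
  | cons v _ ih =>
    refine ih (?_ : IsPosKernel μ (G.rand \ {v}) _)
    rw [Finset.sdiff_singleton_eq_erase]
    exact h.div_kernelCond (G.notMem_mb v)

theorem IsPosDensity.isPosKernel_fixKernel (hp : IsPosDensity μ p) (hG : G.IsADMG) (l : List V) :
    IsPosKernel μ (G.fixSeq l).rand (fixKernel μ G l p) :=
  _root_.isPosKernel_fixKernel (hG ▸ hp.isPosKernel) l

namespace NestedMarkov

variable (h : NestedMarkov μ p G) (hp : IsPosDensity μ p) (hG : G.IsADMG)

include h hp hG

theorem lmarginal_singleton_fixKernel (hl : G.ValidFixing (l ++ [v]))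
    (hv : ∀ u, ¬ (G.fixSeq l).dir v u) :
    lmarginal μ {v} (fixKernel μ G l p) =ᵐ[Measure.pi μ] fixKernel μ G (l ++ [v]) p := by
  obtain ⟨k, hk, hfac⟩ := h
  have hrand : v ∈ (G.fixSeq l).rand := (CADMG.validFixing_append.1 hl).2.1.1
  have hdep : DependsOn (fun x => ∏ D ∈ (G.fixSeq (l ++ [v])).districts, k D x)
      ({v} : Set V)ᶜ := by
    refine dependsOn_finsetProd _ fun D hD =>
      (hk D (CADMG.intrinsic_of_mem_districts hG hl hD)).dependsOn.mono <|
        Set.subset_compl_singleton_iff.2 fun hvD => ?_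
    have hDrand := CADMG.subset_rand_of_mem_districts hD
    rw [CADMG.rand_fixSeq] at hDrand
    rcases Finset.mem_union.1 hvD with hvD | hvD
    · simpa using hDrand hvD
    · obtain ⟨u, hu, hvu⟩ := CADMG.mem_parents.1 hvD
      have hul : u ∉ l.toFinset := fun hul => by simpa [List.mem_toFinset.1 hul] using hDrand hu
      rw [CADMG.fixSeq_eq_fixSet] at hv
      exact hv u ⟨hvu, hul⟩
  refine ((hp.isPosKernel_fixKernel hG l).lmarginal_singleton_ae_eq_of_div_kernelCond hrand
    (CADMG.notMem_mb (G.fixSeq l) v) hdep ?_).trans (hfac _ hl).symm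
  rw [← fixKernel_append_singleton]
  exact hfac _ hl

theorem exists_lmarginal_fixKernel_ae_eq (hl : G.ValidFixing l) (hT : T ⊆ (G.fixSeq l).rand)
    (hchild : ∀ u ∈ T, ∀ w, (G.fixSeq l).dir u w → w ∈ T) :
    ∃ l', G.ValidFixing (l ++ l') ∧ l'.toFinset = T ∧
      lmarginal μ T (fixKernel μ G l p) =ᵐ[Measure.pi μ] fixKernel μ G (l ++ l') p := by
  induction hn : T.card generalizing l T with
  | zero =>
    obtain rfl := Finset.card_eq_zero.1 hn
    exact ⟨[], by simpa using hl, rfl, by simp⟩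
  | succ n ih =>
    obtain ⟨v, hv, hmax⟩ :=
      (G.fixSeq l).exists_mem_forall_not_transGen_dir (Finset.card_pos.1 (by omega : 0 < T.card))
    have hchildless : ∀ u, ¬ (G.fixSeq l).dir v u := fun u hvu =>
      hmax u (hchild v hv u hvu) (.single hvu)
    have hlv : G.ValidFixing (l ++ [v]) := CADMG.validFixing_append.2
      ⟨hl, CADMG.fixable_of_childless (hT hv) hchildless, trivial⟩
    obtain ⟨l', hl', hl'T, heq⟩ := ih (T := T.erase v) hlv
      (by rw [CADMG.rand_fixSeq] at hT ⊢; grind [List.mem_toFinset])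
      (fun u hu w huw => by
        rw [CADMG.fixSeq_append] at huw
        exact Finset.mem_erase.2 ⟨by simpa using huw.2,
          hchild u (Finset.mem_of_mem_erase hu) w huw.1⟩)
      (by rw [Finset.card_erase_of_mem hv, hn, Nat.add_sub_cancel])
    simp only [List.append_assoc, List.singleton_append] at hl' heq
    refine ⟨v :: l', hl', by rw [List.toFinset_cons, hl'T, Finset.insert_erase hv], ?_⟩
    rw [← lmarginal_lmarginal_sdiff (hp.isPosKernel_fixKernel hG l).measurable
      (Finset.singleton_subset_iff.2 hv), Finset.sdiff_singleton_eq_erase]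
    exact (lmarginal_congr_ae (h.lmarginal_singleton_fixKernel hp hG hlv hchildless) _).trans heq

-- The vertices outside of the ancestral set are margined out, that is, fixed. In the remaining
-- CADMG no district has both `a` and `b` among its members and parents.
theorem kernelIndep_of_mSep (hl : G.ValidFixing l) (hab : a ≠ b)
    (ha : a ∉ C ∪ l.toFinset) (hb : b ∉ C ∪ l.toFinset)
    (hanc : (G.fixSeq l).IsAncestral (insert a (insert b (C ∪ l.toFinset))))
    (hsep : (G.fixSeq l).MSep a b (C ∪ l.toFinset)) :
    KernelIndep μ (G.fixSeq l).rand (fixKernel μ G l p) a b C := by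
  obtain ⟨haC, hal⟩ := not_or.1 (Finset.mem_union.not.1 ha)
  obtain ⟨hbC, hbl⟩ := not_or.1 (Finset.mem_union.not.1 hb)
  have hrand : (G.fixSeq l).rand = Finset.univ \ l.toFinset := by rw [CADMG.rand_fixSeq, hG]
  obtain ⟨l', hl', hl'T, heq⟩ := h.exists_lmarginal_fixKernel_ae_eq hp hG hl
    (T := (G.fixSeq l).rand \ insert a (insert b C)) Finset.sdiff_subset fun u hu w huw => by
      have hw := (G.fixSeq l).dir_rand u w huw
      have := hanc u w huw
      grind
  have hsep' : (G.fixSeq (l ++ l')).MSep a b (Finset.univ \ {a, b}) := by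
    have hunion : C ∪ l.toFinset ∪ l'.toFinset = Finset.univ \ {a, b} := by grind
    rw [CADMG.fixSeq_append, CADMG.fixSeq_eq_fixSet _ l', ← hunion]
    exact hsep.fixSet _
  obtain ⟨k, hk, hfac⟩ := h
  refine kernelIndep_of_kernelMargin_ae_eq_prod (hp.isPosKernel_fixKernel hG l).measurable
    (by grind) (by grind) hab haC hbC
    (fun D hD => hk D (CADMG.intrinsic_of_mem_districts hG hl' hD)) (fun D hD haD hbD => ?_)
    (heq.trans (hfac _ hl'))
  have hDl : Disjoint (l ++ l').toFinset D := by
    have := CADMG.subset_rand_of_mem_districts hD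
    rw [CADMG.rand_fixSeq] at this
    exact Finset.disjoint_of_subset_right this Finset.disjoint_sdiff
  rw [← CADMG.parents_fixSet_of_disjoint hDl, ← CADMG.fixSeq_eq_fixSet] at haD hbD
  exact CADMG.not_mSep_of_mem_districts hD hab haD hbD hsep'

theorem densityIndep_of_mSep (hab : a ≠ b) (ha : a ∉ C) (hb : b ∉ C)
    (hanc : G.IsAncestral (insert a (insert b C))) (hsep : G.MSep a b C) :
    DensityIndep μ p a b C := by
  rw [DensityIndep, ← hG]
  rw [← C.union_empty] at ha hb hanc hsep
  exact h.kernelIndep_of_mSep hp hG (l := []) trivial hab ha hb hanc hsep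

end NestedMarkov

end NestedMarkovModels

namespace FrontDoor

open Var

section Graphs

variable {G : CADMG Var} {C : Finset Var} {u v : Var}

/-- The position of a variable in the order `Z, A, M, Y`. -/
def rank : Var → ℕ
  | Z => 0
  | A => 1
  | M => 2
  | Y => 3

/-- The ADMGs that contain `A → M → Y` and have the topological order `Z, A, M, Y`, a common
weakening of the pattern and of the assumptions on `G` about directed paths. -/
structure Ordered (G : CADMG Var) : Prop where
  isADMG : G.IsADMG
  isTopological : G.IsTopological rank
  dir_A_M : G.dir A M
  dir_M_Y : G.dir M Y

theorem rank_injective : Function.Injective rank := by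
  intro u v
  cases u <;> cases v <;> simp [rank]

theorem ordered_of_mediates (hG : G.IsADMG) (hM : Mediates G) (hZ : NotConsequence G) :
    Ordered G := by
  have hreach : ∀ u v, v ≠ Z → rank v ≤ rank u → Relation.ReflTransGen G.dir v u := by
    intro u v hvZ hvu
    rcases u <;> rcases v <;> first
      | exact .refl
      | exact hM.1.to_reflTransGen
      | exact hM.2.to_reflTransGen
      | exact (hM.1.trans hM.2).to_reflTransGen
      | simp [rank] at hvu hvZ
  have hlt : ∀ u v, G.dir u v → rank u < rank v := by
    intro u v huv
    by_contra! hvu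
    rcases eq_or_ne v Z with rfl | hvZ
    · have huZ : u ≠ Z := fun huZ => G.acyclic Z (.single (huZ ▸ huv))
      have hAu : rank A ≤ rank u := Nat.pos_of_ne_zero fun h => huZ (rank_injective h)
      exact hZ (.tail' (hreach u A (by simp) hAu) huv)
    · exact G.acyclic u (.head' huv (hreach u v hvZ hvu))
  refine ⟨hG, ⟨rank_injective, hlt⟩, ?_, ?_⟩
  · obtain ⟨u, hAu, huM⟩ := Relation.TransGen.tail'_iff.1 hM.1
    rcases u
    · exact absurd ((Relation.reflTransGen_iff_eq_or_transGen.1 hAu).resolve_left (by simp)) hZ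
    · exact huM
    · simpa using hlt _ _ huM
    · simpa [rank] using hlt _ _ huM
  · obtain ⟨u, hMu, -⟩ := Relation.TransGen.head'_iff.1 hM.2
    rcases u <;> first
      | exact hMu
      | simpa [rank] using hlt _ _ hMu

theorem exists_hasEdge_of_anchor (h : G.dir Z A ∨ G.bi Z A) :
    ∃ k : EdgeKind, G.HasEdge Z k A ∧ k.headAtEnd :=
  h.elim (fun h => ⟨.fwd, h, trivial⟩) fun h => ⟨.bidir, h, trivial⟩

namespace Ordered

variable (hG : Ordered G)

include hG

theorem mem_rand (v : Var) : v ∈ G.rand := by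
  rw [hG.isADMG]
  exact Finset.mem_univ v

theorem rank_lt (h : G.dir u v) : rank u < rank v := hG.isTopological.2 u v h

theorem not_dir_Y (v : Var) : ¬ G.dir Y v := fun h => by
  cases v <;> simpa [rank] using hG.rank_lt h

theorem eq_Y_of_dir_M (h : G.dir M v) : v = Y := by
  have := hG.rank_lt h
  cases v <;> simp_all [rank]

theorem isAncestral_Z_A : G.IsAncestral {Z, A} := by
  intro u v huv hv
  have := hG.rank_lt huv
  cases u <;> cases v <;> simp_all [rank]

theorem isAncestral_M_Z_A : G.IsAncestral {M, Z, A} := by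
  intro u v huv hv
  have := hG.rank_lt huv
  cases u <;> cases v <;> simp_all [rank]

theorem anchor (h : ¬ G.MSep Z A ∅) : G.dir Z A ∨ G.bi Z A := by
  contrapose! h
  refine CADMG.mSep_of_forall_not_bi hG.isAncestral_Z_A (by simp) h.1 (fun u hu hAu => ?_)
    (by simpa using h.2)
  obtain rfl : u = Z := by simpa using hu
  simpa [rank] using hG.rank_lt hAu

theorem mSep_Z_Y_of_forall_not_bi_Y (hdir : ¬ G.dir Z Y) (hbi : ∀ u, ¬ G.bi u Y) :
    G.MSep Z Y {A, M} :=
  CADMG.mSep_of_forall_not_bi (fun u _ _ _ => by cases u <;> simp) (by simp) hdir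
    (fun v _ => hG.not_dir_Y v) fun u _ => hbi u

theorem mSep_Z_Y_of_isolated_Z_A (hdir : ∀ v, G.dir Z v → v = A)
    (hbi_Z : ∀ v, G.bi Z v → v = A) (hbi_A : ∀ v, G.bi A v → v = Z) : G.MSep Z Y {A, M} := by
  refine CADMG.mSep_of_isAncestral {Z, A} (fun u _ _ _ => by cases u <;> simp) (by simp) (by simp)
    (fun v hv => .inr (hdir v hv)) (fun v _ _ => hG.not_dir_Y v) ?_
  rintro u - (rfl | rfl) v huv
  exacts [.inr (hbi_Z v huv), .inl (hbi_A v huv)]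

-- Given `A`, all edges of `Z` and `A` that would connect these two with `M` or `Y` give open paths.
theorem not_mSep_Z_Y_of_A_mem (hanchor : G.dir Z A ∨ G.bi Z A) (hsep : ¬ G.MSep Z Y {A, M})
    (hY : Y ∉ C) (hZ : Z ∉ C) (hA : A ∈ C) : ¬ G.MSep Z Y C := by
  intro hC
  obtain ⟨k, hk, hhead⟩ := exists_hasEdge_of_anchor hanchor
  have hM : M ∉ C := fun hM => by
    have hC_eq : C = {A, M} := by
      ext u
      cases u <;> simp_all
    exact hsep (hC_eq ▸ hC)
  have hdir_ZY : ¬ G.dir Z Y := fun h => CADMG.not_mSep_of_edge (k := .fwd) (by simp) h hC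
  have hbi_ZY : ¬ G.bi Z Y := fun h => CADMG.not_mSep_of_edge (k := .bidir) (by simp) h hC
  have hdir_ZM : ¬ G.dir Z M := fun h => CADMG.not_mSep_of_nonCollider (k₁ := .fwd)
    (k₂ := .fwd) (by simp) h hG.dir_M_Y And.right hM hC
  have hbi_ZM : ¬ G.bi Z M := fun h => CADMG.not_mSep_of_nonCollider (k₁ := .bidir)
    (k₂ := .fwd) (by simp) h hG.dir_M_Y And.right hM hC
  have hbi_AY : ¬ G.bi A Y := fun h =>
    CADMG.not_mSep_of_collider (k₂ := .bidir) (by simp) hk h ⟨hhead, trivial⟩ hA hC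
  have hbi_AM : ¬ G.bi A M := fun h =>
    CADMG.not_mSep_of_openWalk (l := [(k, A), (.bidir, M), (.fwd, Y)]) (by simp) (by simp)
      (by simp) ⟨hk, fun _ => ⟨A, hA, .refl⟩, fun hn => absurd ⟨hhead, trivial⟩ hn, h,
        fun hc => hc.2.elim, fun _ => hM, hG.dir_M_Y⟩ hC
  refine hsep (hG.mSep_Z_Y_of_isolated_Z_A ?_ ?_ ?_) <;> intro v hv <;> cases v <;>
    first
    | rfl
    | exact absurd hv ‹_›
    | exact absurd hv (G.bi_irrefl _)
    | exact absurd (.single hv) (G.acyclic _)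

-- Given `M`, all bidirected edges of `Y` give open paths; given neither `A` nor `M`, the path
-- along the anchor edge and `A → M → Y` is open.
theorem not_mSep_Z_Y_of_A_notMem (hanchor : G.dir Z A ∨ G.bi Z A) (hsep : ¬ G.MSep Z Y {A, M})
    (hA : A ∉ C) : ¬ G.MSep Z Y C := by
  intro hC
  obtain ⟨k, hk, hhead⟩ := exists_hasEdge_of_anchor hanchor
  have hM : M ∈ C := by
    by_contra hM
    exact CADMG.not_mSep_of_openWalk (l := [(k, A), (.fwd, M), (.fwd, Y)]) (by simp) (by simp)
      (by simp) ⟨hk, fun hc => hc.2.elim, fun _ => hA, hG.dir_A_M, fun hc => hc.2.elim,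
        fun _ => hM, hG.dir_M_Y⟩ hC
  have hdir_ZY : ¬ G.dir Z Y := fun h => CADMG.not_mSep_of_edge (k := .fwd) (by simp) h hC
  have hbi_ZY : ¬ G.bi Z Y := fun h => CADMG.not_mSep_of_edge (k := .bidir) (by simp) h hC
  have hbi_AY : ¬ G.bi A Y := fun h =>
    CADMG.not_mSep_of_openWalk (l := [(k, A), (.bidir, Y)]) (by simp) (by simp)
      (by simp) ⟨hk, fun _ => ⟨M, hM, .single hG.dir_A_M⟩,
        fun hn => absurd ⟨hhead, trivial⟩ hn, h⟩ hC
  have hbi_MY : ¬ G.bi M Y := fun h =>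
    CADMG.not_mSep_of_openWalk (l := [(k, A), (.fwd, M), (.bidir, Y)]) (by simp) (by simp)
      (by simp) ⟨hk, fun hc => hc.2.elim, fun _ => hA, hG.dir_A_M, fun _ => ⟨M, hM, .refl⟩,
        fun hn => absurd ⟨trivial, trivial⟩ hn, h⟩ hC
  refine hsep (hG.mSep_Z_Y_of_forall_not_bi_Y hdir_ZY fun u hu => ?_)
  cases u
  exacts [hbi_ZY hu, hbi_AY hu, hbi_MY hu, G.bi_irrefl _ hu]

theorem not_mSep_Z_Y (hanchor : G.dir Z A ∨ G.bi Z A) (hsep : ¬ G.MSep Z Y {A, M})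
    (hZ : Z ∉ C) (hY : Y ∉ C) : ¬ G.MSep Z Y C :=
  if hA : A ∈ C then hG.not_mSep_Z_Y_of_A_mem hanchor hsep hY hZ hA
  else hG.not_mSep_Z_Y_of_A_notMem hanchor hsep hA

end Ordered

namespace Admissible

variable (hG : Admissible G)

include hG

theorem ordered : Ordered G :=
  ordered_of_mediates hG.isADMG hG.mediates hG.notConsequence

theorem anchor : G.dir Z A ∨ G.bi Z A := hG.ordered.anchor hG.relevant_A

theorem not_dir_Z_Y : ¬ G.dir Z Y := fun h =>
  CADMG.not_mSep_of_edge (G := G.fixSet {M}) (k := .fwd) (by simp) ⟨h, by simp⟩ hG.mSep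

theorem not_bi_Z_Y : ¬ G.bi Z Y := fun h =>
  CADMG.not_mSep_of_edge (G := G.fixSet {M}) (k := .bidir) (by simp) ⟨h, by simp, by simp⟩ hG.mSep

theorem not_dir_A_Y : ¬ G.dir A Y := fun h => by
  obtain ⟨k, hk, -⟩ := exists_hasEdge_of_anchor (G := G.fixSet {M})
    (hG.anchor.imp (fun h => ⟨h, by simp⟩) fun h => ⟨h, by simp, by simp⟩)
  exact CADMG.not_mSep_of_nonCollider (k₂ := .fwd) (by simp) hk ⟨h, by simp⟩ (fun h => h.2)
    (by simp) hG.mSep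

theorem not_transGen_bi_M_Y : ¬ Relation.TransGen G.bi M Y :=
  hG.identified.not_transGen_bi hG.ordered.dir_M_Y

theorem bi_A_Y : G.bi A Y := by
  by_contra hAY
  refine hG.relevant_Y (hG.ordered.mSep_Z_Y_of_forall_not_bi_Y hG.not_dir_Z_Y fun u hu => ?_)
  cases u
  exacts [hG.not_bi_Z_Y hu, hAY hu, hG.not_transGen_bi_M_Y (.single hu), G.bi_irrefl _ hu]

theorem not_transGen_bi_A_M : ¬ Relation.TransGen G.bi A M := fun h =>
  hG.not_transGen_bi_M_Y ((CADMG.transGen_bi_symm h).tail hG.bi_A_Y)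

theorem inPattern : InPattern G where
  isADMG := hG.isADMG
  dir_A_M := hG.ordered.dir_A_M
  dir_M_Y := hG.ordered.dir_M_Y
  bi_A_Y := hG.bi_A_Y
  dir_only u v h := by
    have := hG.ordered.rank_lt h
    have := hG.not_dir_Z_Y
    have := hG.not_dir_A_Y
    cases u <;> cases v <;> simp_all [rank]
  bi_only u v h := by
    have hsymm := G.bi_symm _ _ h
    have hMY : ¬ G.bi M Y := fun h => hG.not_transGen_bi_M_Y (.single h)
    have hAM : ¬ G.bi A M := fun h => hG.not_transGen_bi_A_M (.single h)
    have := hG.not_bi_Z_Y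
    have := G.bi_irrefl
    cases u <;> cases v <;> simp_all
  anchor := hG.anchor
  no_path := hG.not_transGen_bi_A_M

end Admissible

namespace InPattern

variable (hG : InPattern G)

include hG

theorem ordered : Ordered G where
  isADMG := hG.isADMG
  isTopological := ⟨rank_injective, fun u v h => by
    rcases hG.dir_only u v h with h | h | h | h <;> simp [h, rank]⟩
  dir_A_M := hG.dir_A_M
  dir_M_Y := hG.dir_M_Y

theorem noBidirectedPathToChild : NoBidirectedPathToChild G := by
  intro c hc
  obtain rfl : c = M := by simpa using hG.dir_only _ _ hc
  exact hG.no_path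

theorem not_dir_A_Y : ¬ G.dir A Y := fun h => by simpa using hG.dir_only _ _ h

theorem not_bi_M_Y : ¬ G.bi M Y := fun h => by simpa using hG.bi_only _ _ h

theorem not_transGen_bi_M_Y : ¬ Relation.TransGen G.bi M Y := fun h =>
  hG.no_path (CADMG.transGen_bi_symm (h.tail (G.bi_symm _ _ hG.bi_A_Y)))

theorem fixable_M : G.Fixable M := by
  refine ⟨hG.ordered.mem_rand M, fun u _ _ ⟨hdir, hbi⟩ => ?_⟩
  obtain ⟨v, hMv, hvu⟩ := Relation.TransGen.head'_iff.1 hdir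
  obtain rfl := hG.ordered.eq_Y_of_dir_M hMv
  rcases hvu.cases_head with rfl | ⟨w, hYw, -⟩
  exacts [hG.not_transGen_bi_M_Y hbi, hG.ordered.not_dir_Y w hYw]

theorem identified_M : G.Identified {M} := fun _ hD =>
  CADMG.intrinsic_of_mem_districts hG.isADMG (l := [M]) ⟨hG.fixable_M, trivial⟩ hD

theorem isAncestral_fixSet_M : (G.fixSet {M}).IsAncestral {Z, Y, M} := by
  rintro u v ⟨huv, _⟩ _
  have := hG.dir_only u v huv
  cases u <;> simp_all

theorem mSep_fixSet_M : (G.fixSet {M}).MSep Z Y {M} := by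
  refine CADMG.mSep_of_forall_not_bi hG.isAncestral_fixSet_M (by simp) (fun h => ?_)
    (fun u _ h => hG.ordered.not_dir_Y u h.1) fun u hu h => ?_
  · simpa using hG.dir_only _ _ h.1
  · have := hG.bi_only _ _ h.1
    cases u <;> simp_all

theorem admissible : Admissible G := by
  obtain ⟨k, hk, hhead⟩ := exists_hasEdge_of_anchor hG.anchor
  exact
    { isADMG := hG.isADMG
      mediates := ⟨.single hG.dir_A_M, .single hG.dir_M_Y⟩
      notConsequence := fun h => by
        obtain ⟨u, -, hu⟩ := Relation.TransGen.tail'_iff.1 h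
        simpa [rank] using hG.ordered.rank_lt hu
      relevant_A := CADMG.not_mSep_of_edge (by simp) hk
      relevant_Y := CADMG.not_mSep_of_collider (k₂ := .bidir) (by simp) hk hG.bi_A_Y
        ⟨hhead, trivial⟩ (by simp)
      identified := hG.identified_M
      mSep := hG.mSep_fixSet_M }

theorem mb_M : G.mb M = {A, Z} ∨ G.mb M = {A} := by
  have hM := CADMG.mem_district_self (hG.ordered.mem_rand M)
  have hA : A ∈ G.mb M := CADMG.mem_mb.2 ⟨by simp, .inr ⟨M, hM, hG.dir_A_M⟩⟩
  have hY : Y ∉ G.mb M := fun hY => by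
    rcases (CADMG.mem_mb.1 hY).2 with hY | ⟨u, -, hu⟩
    · exact hG.not_transGen_bi_M_Y ((Relation.reflTransGen_iff_eq_or_transGen.1
        (CADMG.mem_district.1 hY).2).resolve_left (by simp))
    · exact hG.ordered.not_dir_Y u hu
  have := CADMG.notMem_mb G M
  by_cases hZ : Z ∈ G.mb M
  · exact .inl (by ext u; cases u <;> simp_all)
  · exact .inr (by ext u; cases u <;> simp_all)

theorem mSep_M_Z_of_mb_M (hmb : G.mb M = {A}) : G.MSep M Z {A} := by
  have hM := CADMG.mem_district_self (hG.ordered.mem_rand M)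
  have hZ : ¬ (Z ∈ G.district M ∨ ∃ u ∈ G.district M, G.dir Z u) := fun h => by
    simpa [hmb] using CADMG.mem_mb.2 ⟨(by simp : Z ≠ M), h⟩
  have hbi_MZ : ¬ G.bi M Z := fun h =>
    hZ (.inl (CADMG.mem_district.2 ⟨hG.ordered.mem_rand Z, .single h⟩))
  have hbi_MA : ¬ G.bi M A := fun h => hG.no_path (.single (G.bi_symm _ _ h))
  refine CADMG.mSep_of_isAncestral {Z, A}ᶜ hG.ordered.isAncestral_M_Z_A (by simp) (by simp)
    (fun v hv => ?_) (fun u hu huS hZu => ?_) fun u hu huS v huv => ?_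
  · simp [hG.ordered.eq_Y_of_dir_M hv]
  all_goals
    obtain rfl : u = M := by
      cases u <;> simp_all
  · exact hZ (.inr ⟨M, hM, hZu⟩)
  · rintro (rfl | rfl)
    exacts [hbi_MZ huv, hbi_MA huv]

end InPattern

end Graphs

section Models

variable {X : Var → Type*} [∀ v, MeasurableSpace (X v)] {μ : ∀ v, Measure (X v)}
  {p : (∀ v, X v) → ℝ≥0∞} {G : CADMG Var}

theorem gFormula_rank_M (p : (∀ v, X v) → ℝ≥0∞) :
    gFormula μ p rank {M} = fun x => p x / kernelCond μ Finset.univ p M {A, Z} x := by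
  have hpred : (Finset.univ.filter fun u => rank u < rank M) = {A, Z} := by decide
  ext x
  rw [gFormula, Finset.prod_singleton, hpred]

variable [∀ v, SigmaFinite (μ v)]

theorem admissible_of_vermaConstraint (hp : IsPosDensity μ p) (hG : G.IsADMG)
    (h : NestedMarkov μ p G) (hM : Mediates G) (hZ : NotConsequence G)
    (hZA : ¬ DensityIndep μ p Z A ∅) (hZY : ¬ DensityIndep μ p Z Y {A, M})
    (hfaith : VermaFaithful μ p G) (hverma : VermaConstraint μ p) : Admissible G := by
  have hord := ordered_of_mediates hG hM hZ
  have hrel_A : ¬ G.MSep Z A ∅ := fun hsep => hZA <|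
    h.densityIndep_of_mSep hp hG (by simp) (by simp) (by simp) hord.isAncestral_Z_A hsep
  have hrel_Y : ¬ G.MSep Z Y {A, M} := fun hsep => hZY <|
    h.densityIndep_of_mSep hp hG (by simp) (by simp) (by simp)
      (fun u _ _ _ => by cases u <;> simp) hsep
  have hdep : ∀ C : Finset Var, Z ∉ C → Y ∉ C → ¬ DensityIndep μ p Z Y C := fun C hZ hY hind =>
    hord.not_mSep_Z_Y (hord.anchor hrel_A) hrel_Y hZ hY
      (hfaith.ordinary Z Y C (by simp) hZ hY hind)
  have hrand : (Finset.univ \ {M} : Finset Var) = {Z, A, Y} := by decide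
  obtain ⟨hid, hsep⟩ := hfaith.generalized rank {M} ∅ Z Y hord.isTopological (by simp) (by simp)
    (by simp) (by simp) hdep (by rwa [hrand, gFormula_rank_M])
  exact ⟨hG, hM, hZ, hrel_A, hrel_Y, hid, by simpa using hsep⟩

namespace InPattern

variable (hG : InPattern G) (hp : IsPosDensity μ p) (h : NestedMarkov μ p G)

include hG hp h

theorem fixKernel_M_ae_eq : fixKernel μ G [M] p =ᵐ[Measure.pi μ]
    fun x => p x / kernelCond μ Finset.univ p M {A, Z} x := by
  have hfix : fixKernel μ G [M] p = fun x => p x / kernelCond μ Finset.univ p M (G.mb M) x := by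
    rw [← show G.rand = Finset.univ from hG.isADMG]
    rfl
  rw [hfix]
  rcases hG.mb_M with hmb | hmb
  · rw [hmb]
  · have hind : DensityIndep μ p M Z {A} := h.densityIndep_of_mSep hp hG.isADMG (by simp)
      (by simp) (by simp) hG.ordered.isAncestral_M_Z_A (hG.mSep_M_Z_of_mb_M hmb)
    rw [hmb, Finset.pair_comm]
    filter_upwards [hp.isPosKernel.kernelCond_ae_eq_of_kernelIndep hind] with x hx
    rw [hx]

theorem vermaConstraint : VermaConstraint μ p := by
  have hrand : (G.fixSeq [M]).rand = {Z, A, Y} := by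
    rw [CADMG.rand_fixSeq, hG.isADMG]
    decide
  have hind := h.kernelIndep_of_mSep hp hG.isADMG (l := [M]) (C := ∅) ⟨hG.fixable_M, trivial⟩
    (a := Z) (b := Y) (by simp) (by simp) (by simp) hG.isAncestral_fixSet_M hG.mSep_fixSet_M
  rw [hrand] at hind
  exact hind.congr (hG.fixKernel_M_ae_eq hp h)

end InPattern

end Models

end FrontDoor

theorem theorem1 {X : Var → Type*} [∀ v, MeasurableSpace (X v)] (μ : ∀ v, Measure (X v))
    [∀ v, SigmaFinite (μ v)] :
    (∀ (p : (∀ v, X v) → ℝ≥0∞) (G : CADMG Var),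
      IsPosDensity μ p → G.IsADMG → NestedMarkov μ p G →
      FrontDoor.Mediates G →
      FrontDoor.NotConsequence G → ¬ DensityIndep μ p Var.Z Var.A ∅ →
      ¬ DensityIndep μ p Var.Z Var.Y {Var.A, Var.M} →
      VermaFaithful μ p G →
      FrontDoor.VermaConstraint μ p →
      (NestedMarkov μ p G ∧ FrontDoor.NoBidirectedPathToChild G) ∧
      ¬ G.dir Var.A Var.Y ∧
      (¬ G.bi Var.A Var.M ∧ ¬ G.bi Var.M Var.Y) ∧
      FrontDoor.InPattern G) ∧
    (∀ G : CADMG Var, FrontDoor.Admissible G ↔ FrontDoor.InPattern G) ∧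
    (∀ (p : (∀ v, X v) → ℝ≥0∞) (G : CADMG Var),
      IsPosDensity μ p → FrontDoor.InPattern G → NestedMarkov μ p G →
      FrontDoor.VermaConstraint μ p) := by
  refine ⟨fun p G hp hG h hM hZ hZA hZY hfaith hverma => ?_,
    fun G => ⟨fun hG => hG.inPattern, fun hG => hG.admissible⟩,
    fun p G hp hG h => hG.vermaConstraint hp h⟩
  have hpat : FrontDoor.InPattern G :=
    (FrontDoor.admissible_of_vermaConstraint hp hG h hM hZ hZA hZY hfaith hverma).inPattern
  exact ⟨⟨h, hpat.noBidirectedPathToChild⟩, hpat.not_dir_A_Y,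
    ⟨fun hAM => hpat.no_path (.single hAM), hpat.not_bi_M_Y⟩, hpat⟩
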